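/- **Conventions.** For a real random variable $z$, write $z\sim\mathsf{subG}(\sigma^2)$ if $\sup_{p\ge 1}p^{-1/2}(\mathbb{E}|z|^p)^{1/p}\le\sigma$ (with $\sigma\ge 0$). For a random vector $z\in\mathbb{R}^d$, write $z\sim\mathsf{subG}_d(\tau^2)$ if $\langle\theta,z\rangle\sim\mathsf{subG}(\tau^2)$ for every $\theta$ with $\|\theta\|_2=1$. $A^\dagger$ denotes the Moore–Penrose pseudoinverse, and $\lambda_{\min},\lambda_{\max}$ the extreme eigenvalues of a symmetric matrix. **Setting.** Let $d=d_1+d_2\ge 1$ and $n\ge 2$, and let $(x_1,y_1),\dots,(x_n,y_n)$ be i.i.d. from a probability distribution $\mathcal{D}$ on $\mathbb{R}^d\times\mathbb{R}$ such that $x\sim\mathsf{subG}_d(\tau^2)$ and $y\sim\mathsf{subG}(\sigma^2)$. Partition $x=(x^{(1)},x^{(2)})$ with $x^{(1)}\in\mathbb{R}^{d_1}$, $x^{(2)}\in\mathbb{R}^{d_2}$. Put $\Sigma=\mathbb{E}[xx^\top]$ and $\Sigma_1=\mathbb{E}[x^{(1)}x^{(1)\top}]$, and assume $\Sigma\succ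 0$. Let $\beta^\star$ minimize $\beta\mapsto\mathbb{E}(\langle\beta,x\rangle-y)^2$ over $\mathbb{R}^d$, let $\beta_1^\star$ minimize $\beta\mapsto\mathbb{E}(\langle\beta,x^{(1)}\rangle-y)^2$ over $\mathbb{R}^{d_1}$, and define $$\mathcal{E}=\mathbb{E}\big(\langle\beta_1^\star,x^{(1)}\rangle-\langle\beta^\star,x\rangle\big)^2 .$$ **Estimator.** Given symmetric matrices $\widehat\Sigma\in\mathbb{R}^{d\times d}$ and $\widehat\Sigma_1\in\mathbb{R}^{d_1\times d_1}$, put $$\widehat R=\widehat D^\dagger-\widehat\Sigma^\dagger,\quad \widehat D=\begin{pmatrix}\widehat\Sigma_1&0\\0&0\end{pmatrix},\qquad \widehat{\mathcal{E}}=\frac{1}{\binom n2}\sum_{s<t}\big\langle\widehat\Sigma^{1/2}\widehat R\,x_sy_s,\ \widehat\Sigma^{1/2}\widehat R\,x_ty_t\big\rangle .$$ **Theorem.** There is a universal constant $C>0$ such that, in every setting as above, for all $\varepsilon\le 1/2$, all $\delta\in(0,1)$ and all deterministic symmetric matrices $\widehat\Sigma,\widehat\Sigma_1$ for which every eigenvalue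 $t$ of $\Sigma^{-1/2}\widehat\Sigma\Sigma^{-1/2}$ and every eigenvalue $t$ of $\Sigma_1^{-1/2}\widehat\Sigma_1\Sigma_1^{-1/2}$ satisfies $t\geq 0$ and $1-\varepsilon\le t^{1/2}\le 1+\varepsilon$, with probability at least $1-\delta$ over the sample, $$|\widehat{\mathcal{E}}-\mathcal{E}|\le\frac12\mathcal{E}+C\left(\frac{\lambda_{\max}(\Sigma)}{\lambda_{\min}^2(\Sigma)}\cdot\frac{\sigma^2\tau^2d^{1/2}\log^2(2d/\delta)}{n}+\frac{\lambda_{\max}(\Sigma)}{\lambda_{\min}^2(\Sigma)}\,\|\mathbb{E}[xy]\|_2^2\,\varepsilon^2\right).$$ -/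

import Mathlib

open MeasureTheory
open scoped ENNReal MatrixOrder

/-- `z ∼ subG(σ²)` under `P`: `sup_{p ≥ 1} p^{-1/2} (E |z|^p)^{1/p} ≤ σ`. -/
def IsSubG {Ω : Type*} [MeasurableSpace Ω] (P : Measure Ω) (z : Ω → ℝ) (σ : ℝ) : Prop :=
  ∀ p : ℝ, 1 ≤ p →
    ENNReal.ofReal (p ^ (-(1 / 2) : ℝ)) * eLpNorm z (ENNReal.ofReal p) P ≤ ENNReal.ofReal σ

/-- `z ∼ subG_d(τ²)` under `P`: `⟨θ, z⟩ ∼ subG(τ²)` for every unit vector `θ`. -/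
def IsSubGVec {Ω ι : Type*} [MeasurableSpace Ω] [Fintype ι] (P : Measure Ω)
    (z : Ω → EuclideanSpace ℝ ι) (τ : ℝ) : Prop :=
  ∀ θ : EuclideanSpace ℝ ι, ‖θ‖ = 1 → IsSubG P (fun ω => inner ℝ θ (z ω)) τ

/-- The uncentered second moment matrix `E[z zᵀ]`. -/
noncomputable def secondMoment {Ω ι : Type*} [MeasurableSpace Ω] (P : Measure Ω)
    (z : Ω → EuclideanSpace ℝ ι) : Matrix ι ι ℝ :=
  Matrix.of fun i j => ∫ ω, z ω i * z ω j ∂P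

/-- The first block `x⁽¹⁾` of `x = (x⁽¹⁾, x⁽²⁾)`. -/
def firstBlock {ι κ : Type*} (x : EuclideanSpace ℝ (ι ⊕ κ)) : EuclideanSpace ℝ ι :=
  WithLp.toLp 2 fun i => x (Sum.inl i)

/-- `β` minimizes the expected square loss `E (⟨β, z⟩ - y)²` over all linear predictors. -/
def IsBestLinearPredictor {Ω ι : Type*} [MeasurableSpace Ω] [Fintype ι] (P : Measure Ω)
    (z : Ω → EuclideanSpace ℝ ι) (y : Ω → ℝ) (β : EuclideanSpace ℝ ι) : Prop :=
  IsMinOn (fun b : EuclideanSpace ℝ ι => ∫ ω, (inner ℝ b (z ω) - y ω) ^ 2 ∂P) Set.univ β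

/-- Smallest eigenvalue of a (symmetric) real matrix. -/
noncomputable def lamMin {ι : Type*} [Fintype ι] [DecidableEq ι] (A : Matrix ι ι ℝ) : ℝ :=
  sInf (spectrum ℝ A)

/-- Largest eigenvalue of a (symmetric) real matrix. -/
noncomputable def lamMax {ι : Type*} [Fintype ι] [DecidableEq ι] (A : Matrix ι ι ℝ) : ℝ :=
  sSup (spectrum ℝ A)

/-- Every eigenvalue `t` of `Σ^{-1/2} S Σ^{-1/2}` satisfies `1 - ε ≤ t^{1/2} ≤ 1 + ε`
(here `S` is the estimate of `Σ = Sig`). -/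
def SpectrallyClose {ι : Type*} [Fintype ι] [DecidableEq ι] (Sig S : Matrix ι ι ℝ) (ε : ℝ) :
    Prop :=
  ∀ t ∈ spectrum ℝ ((CFC.sqrt Sig)⁻¹ * S * (CFC.sqrt Sig)⁻¹),
    1 - ε ≤ Real.sqrt t ∧ Real.sqrt t ≤ 1 + ε

/-- `B` is a Moore–Penrose pseudoinverse of the real square matrix `A`. -/
def IsPseudoinverse {ι : Type*} [Fintype ι] (A B : Matrix ι ι ℝ) : Prop :=
  A * B * A = A ∧ B * A * B = B ∧ (A * B).transpose = A * B ∧ (B * A).transpose = B * A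

theorem IsPseudoinverse.unique {ι : Type*} [Fintype ι] {A B C : Matrix ι ι ℝ}
    (hB : IsPseudoinverse A B) (hC : IsPseudoinverse A C) : B = C := by
  obtain ⟨b1, b2, b3, b4⟩ := hB
  obtain ⟨c1, c2, c3, c4⟩ := hC
  have h1 : A * B = A * C := by
    calc A * B = (A * C) * (A * B) := by rw [← Matrix.mul_assoc, c1]
      _ = ((A * B) * (A * C)).transpose := by rw [Matrix.transpose_mul, b3, c3]
      _ = (A * C).transpose := by rw [← Matrix.mul_assoc, b1]
      _ = A * C := c3
  have h2 : B * A = C * A := by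
    calc B * A = (B * A) * (C * A) := by rw [Matrix.mul_assoc, ← Matrix.mul_assoc A, c1]
      _ = ((C * A) * (B * A)).transpose := by rw [Matrix.transpose_mul, b4, c4]
      _ = (C * A).transpose := by rw [Matrix.mul_assoc, ← Matrix.mul_assoc A, b1]
      _ = C * A := c4
  calc B = B * A * B := b2.symm
    _ = C * A * C := by rw [h2, Matrix.mul_assoc, h1, ← Matrix.mul_assoc]
    _ = C := c2

theorem IsPseudoinverse.exists_of_isHermitian {ι : Type*} [Fintype ι] [DecidableEq ι]
    {A : Matrix ι ι ℝ} (hA : A.IsHermitian) : ∃ B, IsPseudoinverse A B := by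
  have hs : IsSelfAdjoint A := hA
  have hc (f : ℝ → ℝ) : ContinuousOn f (spectrum ℝ A) := A.finite_real_spectrum.continuousOn f
  have e1 : A * cfc (fun t : ℝ => t⁻¹) A = cfc (fun t : ℝ => t * t⁻¹) A := by
    rw [cfc_mul (fun t : ℝ => t) _ A (hc _) (hc _), cfc_id' ℝ A]
  have e2 : cfc (fun t : ℝ => t⁻¹) A * A = cfc (fun t : ℝ => t * t⁻¹) A := by
    rw [← e1]; exact (cfc_commute_cfc (fun t : ℝ => t⁻¹) (fun t : ℝ => t) A).eq.trans (by
      rw [cfc_id' ℝ A]) |> fun h => by rwa [cfc_id' ℝ A] at h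
  have e3 (f : ℝ → ℝ) : (cfc f A).transpose = cfc f A := by
    have h : IsSelfAdjoint (cfc f A) := cfc_predicate f A
    rw [← Matrix.conjTranspose_eq_transpose_of_trivial]; exact h
  refine ⟨cfc (fun t : ℝ => t⁻¹) A, ?_, ?_, ?_, ?_⟩
  · rw [e1]
    nth_rw 2 [← cfc_id' ℝ A]
    rw [← cfc_mul _ _ A (hc _) (hc _)]
    conv_rhs => rw [← cfc_id' ℝ A]
    congr 1; ext t; by_cases h : t = 0 <;> simp [h]
  · rw [e2, ← cfc_mul _ _ A (hc _) (hc _)]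
    congr 1; ext t; by_cases h : t = 0 <;> simp [h]
  · rw [e1, e3]
  · rw [e2, e3]

open Classical in
/-- The Moore–Penrose pseudoinverse `A†`. -/
noncomputable def pinv {ι : Type*} [Fintype ι] (A : Matrix ι ι ℝ) : Matrix ι ι ℝ :=
  if h : ∃ B, IsPseudoinverse A B then h.choose else 0

theorem pinv_eq_of_isPseudoinverse {ι : Type*} [Fintype ι] {A B : Matrix ι ι ℝ}
    (h : IsPseudoinverse A B) : pinv A = B := by
  have h' : ∃ B, IsPseudoinverse A B := ⟨B, h⟩
  rw [pinv, dif_pos h']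
  exact h'.choose_spec.unique h

/-- `R̂ = D̂† - Σ̂†` with `D̂ = diag(Σ̂₁, 0)`. -/
noncomputable def residualMatrix {ι κ : Type*} [Fintype ι] [Fintype κ]
    (S : Matrix (ι ⊕ κ) (ι ⊕ κ) ℝ) (S₁ : Matrix ι ι ℝ) : Matrix (ι ⊕ κ) (ι ⊕ κ) ℝ :=
  pinv (Matrix.fromBlocks S₁ 0 0 0) - pinv S

/-- The output `Ê` of `EstimateResidual` on the examples `(x₁, y₁), …, (xₙ, yₙ)` and the second
moment matrix estimates `S = Σ̂`, `S₁ = Σ̂₁`. -/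
noncomputable def estimateResidual {ι κ : Type*} [Fintype ι] [Fintype κ] [DecidableEq ι]
    [DecidableEq κ] {n : ℕ} (data : Fin n → EuclideanSpace ℝ (ι ⊕ κ) × ℝ)
    (S : Matrix (ι ⊕ κ) (ι ⊕ κ) ℝ) (S₁ : Matrix ι ι ℝ) : ℝ :=
  let w (s : Fin n) : EuclideanSpace ℝ (ι ⊕ κ) :=
    Matrix.toEuclideanLin (CFC.sqrt S * residualMatrix S S₁) ((data s).2 • (data s).1)
  (1 / (n.choose 2 : ℝ)) * ∑ s : Fin n, ∑ t ∈ Finset.Ioi s, inner ℝ (w s) (w t)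

/-!
With `b = E[y x]`, `A = Σ̂^{1/2} R̂` and `ζ = y x - b`, the estimator is the U-statistic of order
two with kernel `⟨A u, A v⟩` evaluated at `ζ_s + b`. Two things are shown: its mean `‖A b‖²` is
close to `𝓔`, and it concentrates around its mean.

*Bias.* The normal equations give `𝓔 = ‖(β₁, 0) - β‖_Σ²`, where `‖v‖_Σ = ‖Σ^{1/2} v‖`, `Σ β = b` and
`Σ₁ β₁ = b⁽¹⁾`, while `‖A b‖` is the `Σ̂`-norm of the same difference for the perturbed systems. The
spectral hypothesis is the Loewner comparison `(1 - ε)² Σ ≤ Σ̂ ≤ (1 + ε)² Σ`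
(`SpectrallyClose.loewnerClose`), under which solving a linear system is stable
(`LoewnerClose.solution_bounds`). Hence `‖A b‖` and `√𝓔` differ by at most a multiple of
`ε ‖b‖ / √λ_min`. Comparing the norms, and not their squares, keeps a term `ε 𝓔` from appearing. The
same estimates give `‖A‖ ≤ 12 / √λ_min`; all factors `1 / λ_min` are finally bounded by
`λ_max / λ_min²`.

*Concentration.* By Cauchy–Schwarz the marginals of `ζ` satisfy `E |⟨θ, ζ⟩| ^ k ≤ (4 σ τ k ‖θ‖) ^ k`
(`centeredSubExpVec_smul`), so a sum of `n` of them has `2m`-th moment of order `(m σ τ √n) ^ 2m`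
(`SubExpMoments.lintegral_sum_pow_le`). This controls the linear part of the Hoeffding decomposition
`uStat_eq`. The degenerate part is four times the average, over all ways to split the sample in two,
of a bilinear form in the two half sums (`offDiag_eq_average`). Conditionally on one half, such a
form is a linear statistic of the other half, so the moment bound can be applied twice; the squared
norm of a half sum costs a factor `d`, that is, `√d` after taking roots
(`CenteredSubExpVec.lintegral_offDiag_pow_le`). Markov's inequality at a moment order comparable
with `log (2 d / δ)` gives the tail bound (`CenteredSubExpVec.uStat_concentration`).

The cross terms `√𝓔 · (error)` are absorbed into `𝓔 / 2` in `abs_sub_sq_le`.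
-/

/-! ### Sub-exponential moments of scalar sums -/

/-- Moment form of sub-exponential growth: every absolute moment satisfies
`E |X| ^ k ≤ (k K) ^ k`. -/
structure SubExpMoments {α : Type*} [MeasurableSpace α] (μ : Measure α) (X : α → ℝ) (K : ℝ) :
    Prop where
  measurable : Measurable X
  nonneg : 0 ≤ K
  integrable : ∀ k : ℕ, 1 ≤ k → Integrable (fun a => |X a| ^ k) μ
  le : ∀ k : ℕ, 1 ≤ k → ∫ a, |X a| ^ k ∂μ ≤ (k * K) ^ k

theorem SubExpMoments.mono {α : Type*} [MeasurableSpace α] {μ : Measure α} {X : α → ℝ} {K L : ℝ}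
    (h : SubExpMoments μ X K) (hKL : K ≤ L) : SubExpMoments μ X L where
  measurable := h.measurable
  nonneg := h.nonneg.trans hKL
  integrable := h.integrable
  le k hk := (h.le k hk).trans (by have := h.nonneg; gcongr)

/-- The exponential moment of a centred variable with sub-exponential moments. The exponential
series is integrated term by term; the linear term vanishes, and `k ^ k / k! ≤ e ^ k` bounds the
others by a geometric series. -/
theorem SubExpMoments.exp_bound {α : Type*} [MeasurableSpace α] {μ : Measure α}
    [IsProbabilityMeasure μ] {X : α → ℝ} {K : ℝ} (h : SubExpMoments μ X K)
    (h0 : ∫ a, X a ∂μ = 0) {r : ℝ} (hr : |r| * K * Real.exp 1 ≤ 1 / 2) :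
    Integrable (fun a => Real.exp (r * X a)) μ ∧
      ∫ a, Real.exp (r * X a) ∂μ ≤ 1 + 2 * (|r| * K * Real.exp 1) ^ 2 := by
  set q := |r| * K * Real.exp 1 with hq
  have hK := h.nonneg
  have hq0 : 0 ≤ q := by positivity
  have hmeas := h.measurable
  let F : ℕ → α → ℝ := fun k a => (r * X a) ^ k / (k.factorial : ℝ)
  have habs (k : ℕ) (a : α) : ‖F k a‖ = |r| ^ k / (k.factorial : ℝ) * |X a| ^ k := by
    simp only [F, Real.norm_eq_abs, abs_div, abs_pow, abs_mul, mul_pow, Nat.abs_cast]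
    ring
  have hFi (k : ℕ) : Integrable (F k) μ := by
    rcases Nat.eq_zero_or_pos k with rfl | hk
    · simp [F]
    · refine ((h.integrable k hk).const_mul (|r| ^ k / (k.factorial : ℝ))).mono' ?_ ?_
      · exact ((hmeas.const_mul r).pow_const k).div_const _ |>.aestronglyMeasurable
      · exact ae_of_all _ fun a => (habs k a).le
  have hFn (k : ℕ) : ∫ a, ‖F k a‖ ∂μ ≤ q ^ k := by
    rcases Nat.eq_zero_or_pos k with rfl | hk
    · simp [F]
    · simp only [habs]
      rw [integral_const_mul]
      calc |r| ^ k / (k.factorial : ℝ) * ∫ a, |X a| ^ k ∂μ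
          ≤ |r| ^ k / (k.factorial : ℝ) * (k * K) ^ k := by gcongr; exact h.le k hk
        _ = (|r| * K) ^ k * ((k : ℝ) ^ k / (k.factorial : ℝ)) := by
            rw [mul_pow, mul_pow]; ring
        _ ≤ (|r| * K) ^ k * Real.exp k := by
            gcongr; exact Real.pow_div_factorial_le_exp k (by positivity) k
        _ = q ^ k := by rw [hq, mul_pow _ (Real.exp 1), Real.exp_one_pow]
  have hgeo : Summable fun k : ℕ => q ^ k := summable_geometric_of_lt_one hq0 (by linarith)
  have hsn : Summable fun k => ∫ a, ‖F k a‖ ∂μ :=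
    Summable.of_nonneg_of_le (fun k => by positivity) hFn hgeo
  have hexp (a : α) : HasSum (fun k => F k a) (Real.exp (r * X a)) := by
    rw [Real.exp_eq_exp_ℝ]; exact NormedSpace.expSeries_div_hasSum_exp _
  have hsum := hasSum_integral_of_summable_integral_norm hFi hsn
  simp only [(hexp _).tsum_eq] at hsum
  refine ⟨?_, ?_⟩
  · have hm : Measurable fun a => Real.exp (r * X a) := (hmeas.const_mul r).exp
    refine ⟨hm.aestronglyMeasurable, ?_⟩
    have hle : ∫⁻ a, ‖Real.exp (r * X a)‖ₑ ∂μ ≤ ∫⁻ a, ∑' k, ‖F k a‖ₑ ∂μ := by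
      refine lintegral_mono fun a => ?_
      rw [← (hexp a).tsum_eq]
      exact enorm_tsum_le_tsum_enorm
    refine hle.trans_lt ?_
    rw [lintegral_tsum fun k => (hFi k).1.enorm]
    have : (fun k => ∫⁻ a, ‖F k a‖ₑ ∂μ) = fun k => ENNReal.ofReal (∫ a, ‖F k a‖ ∂μ) := by
      funext k
      rw [ofReal_integral_norm_eq_lintegral_enorm (hFi k)]
    rw [this, ← ENNReal.ofReal_tsum_of_nonneg (fun k => by positivity) hsn]
    exact ENNReal.ofReal_lt_top
  · rw [← hsum.tsum_eq, ← hsum.summable.sum_add_tsum_nat_add 2]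
    have h1 : ∑ k ∈ Finset.range 2, ∫ a, F k a ∂μ = 1 := by
      simp [Finset.sum_range_succ, F, integral_const_mul, h0]
    have hs2 : Summable fun k => q ^ (k + 2) := (summable_nat_add_iff 2).2 hgeo
    have h2 : ∑' k, ∫ a, F (k + 2) a ∂μ ≤ ∑' k, q ^ (k + 2) :=
      ((summable_nat_add_iff 2).2 hsum.summable).tsum_le_tsum
        (fun k => (le_abs_self _).trans ((norm_integral_le_integral_norm _).trans (hFn _))) hs2
    have h3 : ∑' k, q ^ (k + 2) = q ^ 2 * (1 - q)⁻¹ := by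
      simp only [pow_add, mul_comm _ (q ^ 2)]
      rw [tsum_mul_left, tsum_geometric_of_lt_one hq0 (by linarith)]
    have h4 : (1 - q)⁻¹ ≤ 2 := by
      rw [inv_le_comm₀ (by linarith) (by norm_num)]; linarith
    rw [h1]
    nlinarith [mul_le_mul_of_nonneg_left h4 (sq_nonneg q)]

/-- An i.i.d. weighted sum at the critical scale `1 / √n` has bounded exponential moments. -/
theorem SubExpMoments.exp_sum_bound {α : Type*} [MeasurableSpace α] {μ : Measure α}
    [IsProbabilityMeasure μ] {X : α → ℝ} {K : ℝ} (h : SubExpMoments μ X K)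
    (h0 : ∫ a, X a ∂μ = 0) {n : ℕ} (hn : 1 ≤ n) (c : Fin n → ℝ) (hc : ∀ i, |c i| ≤ 1)
    {r : ℝ} (hr : |r| * (6 * K * Real.sqrt n) ≤ 1) :
    Integrable (fun x => Real.exp (r * ∑ i, c i * X (x i))) (Measure.pi fun _ : Fin n => μ) ∧
      ∫ x, Real.exp (r * ∑ i, c i * X (x i)) ∂(Measure.pi fun _ : Fin n => μ) ≤ 2 := by
  have hK := h.nonneg
  have hn' : (1 : ℝ) ≤ n := by exact_mod_cast hn
  have hs : 0 < Real.sqrt n := Real.sqrt_pos.2 (by linarith)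
  have he : Real.exp 1 ≤ 3 := by linarith [Real.exp_one_lt_d9]
  -- At this scale each factor of the product of exponential moments is `1 + O(1 / n)`.
  have key (i : Fin n) : |r * c i| * K * Real.exp 1 ≤ 1 / (2 * Real.sqrt n) := by
    rw [le_div_iff₀ (by positivity), abs_mul]
    calc |r| * |c i| * K * Real.exp 1 * (2 * Real.sqrt n)
        ≤ |r| * 1 * K * 3 * (2 * Real.sqrt n) := by gcongr; exact hc i
      _ = |r| * (6 * K * Real.sqrt n) := by ring
      _ ≤ 1 := hr
  have h1s : (1 : ℝ) ≤ Real.sqrt n := Real.one_le_sqrt.2 hn'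
  have hb (i : Fin n) := h.exp_bound h0 (r := r * c i) ((key i).trans (by
    rw [div_le_div_iff₀ (by positivity) (by norm_num)]; linarith))
  have hfun : (fun x : Fin n → α => Real.exp (r * ∑ i, c i * X (x i))) =
      fun x => ∏ i, Real.exp (r * c i * X (x i)) := by
    funext x
    rw [← Real.exp_sum, Finset.mul_sum]
    simp only [mul_assoc]
  rw [hfun]
  refine ⟨Integrable.fintype_prod (f := fun i a => Real.exp (r * c i * X a)) fun i => (hb i).1, ?_⟩
  rw [integral_fintype_prod_eq_prod (fun i a => Real.exp (r * c i * X a))]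
  calc ∏ i, ∫ a, Real.exp (r * c i * X a) ∂μ
      ≤ ∏ _i : Fin n, Real.exp (1 / (2 * n)) := by
        refine Finset.prod_le_prod (fun i _ => integral_nonneg fun a => (Real.exp_pos _).le)
          fun i _ => (hb i).2.trans ?_
        have : 2 * (|r * c i| * K * Real.exp 1) ^ 2 ≤ 1 / (2 * (n : ℝ)) := by
          calc 2 * (|r * c i| * K * Real.exp 1) ^ 2 ≤ 2 * (1 / (2 * Real.sqrt n)) ^ 2 := by
                gcongr; exact key i
            _ = 1 / (2 * (n : ℝ)) := by
                rw [div_pow, mul_pow, Real.sq_sqrt (by positivity)]; field_simp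
        linarith [Real.add_one_le_exp (1 / (2 * (n : ℝ)))]
    _ = Real.exp (1 / 2) := by
        rw [Finset.prod_const, Finset.card_univ, Fintype.card_fin, ← Real.exp_nat_mul]
        congr 1; field_simp
    _ ≤ 2 := by
        rw [← Real.le_log_iff_exp_le (by norm_num)]; linarith [Real.log_two_gt_d9]

/-- Even moments of an i.i.d. weighted sum of centred variables with sub-exponential moments. -/
theorem SubExpMoments.lintegral_sum_pow_le {α : Type*} [MeasurableSpace α] {μ : Measure α}
    [IsProbabilityMeasure μ] {X : α → ℝ} {K : ℝ} (h : SubExpMoments μ X K)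
    (h0 : ∫ a, X a ∂μ = 0) {n : ℕ} (hn : 1 ≤ n) (c : Fin n → ℝ) (hc : ∀ i, |c i| ≤ 1) (m : ℕ) :
    ∫⁻ x, ENNReal.ofReal ((∑ i, c i * X (x i)) ^ (2 * m)) ∂(Measure.pi fun _ : Fin n => μ) ≤
      ENNReal.ofReal (4 * (12 * m * K * Real.sqrt n) ^ (2 * m)) := by
  have hn' : (1 : ℝ) ≤ n := by exact_mod_cast hn
  have hs : 0 < Real.sqrt n := Real.sqrt_pos.2 (by linarith)
  have main (L : ℝ) (hKL : K < L) :
      ∫⁻ x, ENNReal.ofReal ((∑ i, c i * X (x i)) ^ (2 * m)) ∂(Measure.pi fun _ : Fin n => μ) ≤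
      ENNReal.ofReal (4 * (12 * m * L * Real.sqrt n) ^ (2 * m)) := by
    have hL : 0 < L := h.nonneg.trans_lt hKL
    have hL' := h.mono hKL.le
    set D := 6 * L * Real.sqrt n with hD
    have hDpos : 0 < D := by positivity
    obtain ⟨i1, b1⟩ := hL'.exp_sum_bound h0 hn c hc (r := D⁻¹)
      (by rw [abs_of_pos (by positivity), inv_mul_cancel₀ hDpos.ne'])
    obtain ⟨i2, b2⟩ := hL'.exp_sum_bound h0 hn c hc (r := -D⁻¹)
      (by rw [abs_neg, abs_of_pos (by positivity), inv_mul_cancel₀ hDpos.ne'])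
    have hpt (x : ℝ) : x ^ (2 * m) ≤
        ((2 * m : ℕ) * D) ^ (2 * m) * (Real.exp (D⁻¹ * x) + Real.exp (-D⁻¹ * x)) := by
      have e1 : |D⁻¹ * x| ^ (2 * m) / ((2 * m).factorial : ℝ) ≤ Real.exp |D⁻¹ * x| :=
        Real.pow_div_factorial_le_exp _ (abs_nonneg _) _
      have e2 : Real.exp |D⁻¹ * x| ≤ Real.exp (D⁻¹ * x) + Real.exp (-D⁻¹ * x) := by
        rw [neg_mul]
        rcases abs_choice (D⁻¹ * x) with h | h <;> rw [h]
        · linarith [Real.exp_pos (-(D⁻¹ * x))]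
        · linarith [Real.exp_pos (D⁻¹ * x)]
      have e3 : ((2 * m).factorial : ℝ) ≤ ((2 * m : ℕ) : ℝ) ^ (2 * m) := by
        exact_mod_cast Nat.factorial_le_pow (2 * m)
      rw [div_le_iff₀ (by positivity), Even.pow_abs (even_two_mul m), mul_pow] at e1
      have e4 : x ^ (2 * m) = D ^ (2 * m) * (D⁻¹ ^ (2 * m) * x ^ (2 * m)) := by
        rw [← mul_assoc, ← mul_pow, mul_inv_cancel₀ hDpos.ne', one_pow, one_mul]
      rw [e4, mul_pow (_ : ℝ) D]
      calc D ^ (2 * m) * (D⁻¹ ^ (2 * m) * x ^ (2 * m))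
          ≤ D ^ (2 * m) * ((Real.exp (D⁻¹ * x) + Real.exp (-D⁻¹ * x)) *
              ((2 * m : ℕ) : ℝ) ^ (2 * m)) := by
            exact mul_le_mul_of_nonneg_left
              (e1.trans (mul_le_mul e2 e3 (by positivity) (by positivity))) (by positivity)
        _ = _ := by ring
    calc _ ≤ ∫⁻ x, ENNReal.ofReal (((2 * m : ℕ) * D) ^ (2 * m) *
            (Real.exp (D⁻¹ * ∑ i, c i * X (x i)) + Real.exp (-D⁻¹ * ∑ i, c i * X (x i))))
              ∂(Measure.pi fun _ : Fin n => μ) :=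
          lintegral_mono fun x => ENNReal.ofReal_le_ofReal (hpt _)
      _ = ENNReal.ofReal (∫ x, ((2 * m : ℕ) * D) ^ (2 * m) *
            (Real.exp (D⁻¹ * ∑ i, c i * X (x i)) + Real.exp (-D⁻¹ * ∑ i, c i * X (x i)))
              ∂(Measure.pi fun _ : Fin n => μ)) := by
          refine (ofReal_integral_eq_lintegral_ofReal ((i1.add i2).const_mul _) ?_).symm
          exact ae_of_all _ fun x => by dsimp only [Pi.add_apply]; positivity
      _ ≤ _ := by
          apply ENNReal.ofReal_le_ofReal
          rw [integral_const_mul, integral_add i1 i2]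
          have : ((2 * m : ℕ) : ℝ) * D = 12 * m * L * Real.sqrt n := by
            rw [hD]; push_cast; ring
          rw [this, mul_comm]
          gcongr
          linarith
  -- The rescaling needs a positive constant, so `K` is approached from above.
  have hcont : Continuous fun L : ℝ =>
      ENNReal.ofReal (4 * (12 * m * L * Real.sqrt n) ^ (2 * m)) :=
    ENNReal.continuous_ofReal.comp (by fun_prop)
  refine ge_of_tendsto (hcont.continuousWithinAt (s := Set.Ioi K) (x := K)) ?_
  filter_upwards [self_mem_nhdsWithin] with L hL using main L hL

/-- Markov's inequality for a high even moment, at `e` times the moment scale. -/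
theorem measure_gt_le_of_lintegral_pow_le {α : Type*} [MeasurableSpace α] {P : Measure α}
    {Z : α → ℝ} (hZ : Measurable Z) {m : ℕ} (hm : 1 ≤ m) {a B : ℝ} (hB : 0 ≤ B)
    (h : ∫⁻ x, ENNReal.ofReal (Z x ^ (2 * m)) ∂P ≤ ENNReal.ofReal (a * B ^ (2 * m))) :
    P {x | Real.exp 1 * B < |Z x|} ≤ ENNReal.ofReal (a * Real.exp (-(2 * m))) := by
  have hmeas : Measurable fun x => ENNReal.ofReal (Z x ^ (2 * m)) :=
    (hZ.pow_const _).ennreal_ofReal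
  have hev : Even (2 * m) := even_two_mul m
  rcases hB.eq_or_lt with rfl | hB
  · rw [zero_pow (by omega), mul_zero, ENNReal.ofReal_zero, nonpos_iff_eq_zero,
      lintegral_eq_zero_iff hmeas] at h
    refine le_of_eq_of_le ?_ zero_le
    refine measure_mono_null (fun x hx => ?_) h
    have hx' : 0 < |Z x| := by simpa using hx
    have : 0 < Z x ^ (2 * m) := by rw [← hev.pow_abs]; positivity
    simpa using this
  · have h1 := mul_meas_ge_le_lintegral (μ := P) hmeas
      (ENNReal.ofReal ((Real.exp 1 * B) ^ (2 * m)))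
    have hpos : 0 < (Real.exp 1 * B) ^ (2 * m) := by positivity
    have hsub : {x | Real.exp 1 * B < |Z x|} ⊆
        {x | ENNReal.ofReal ((Real.exp 1 * B) ^ (2 * m)) ≤ ENNReal.ofReal (Z x ^ (2 * m))} := by
      intro x hx
      have hx' : Real.exp 1 * B < |Z x| := hx
      apply ENNReal.ofReal_le_ofReal
      rw [← hev.pow_abs (Z x)]
      gcongr
    refine (measure_mono hsub).trans ?_
    rw [← ENNReal.mul_le_mul_iff_right (a := ENNReal.ofReal ((Real.exp 1 * B) ^ (2 * m)))
      (by simpa using hpos) ENNReal.ofReal_ne_top]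
    refine h1.trans (h.trans ?_)
    rw [← ENNReal.ofReal_mul hpos.le]
    apply ENNReal.ofReal_le_ofReal
    have : Real.exp 1 ^ (2 * m) * Real.exp (-(2 * m)) = 1 := by
      rw [Real.exp_one_pow, ← Real.exp_add]; push_cast; simp
    rw [mul_pow]
    calc a * B ^ (2 * m) = a * B ^ (2 * m) * (Real.exp 1 ^ (2 * m) * Real.exp (-(2 * m))) := by
          rw [this, mul_one]
      _ ≤ _ := le_of_eq (by ring)

/-! ### Decoupling and moments of the degenerate part -/

/-- A centred random vector all of whose one-dimensional marginals have sub-exponential moments. -/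
structure CenteredSubExpVec {α ι : Type*} [MeasurableSpace α] [Fintype ι] (μ : Measure α)
    (ζ : α → EuclideanSpace ℝ ι) (K : ℝ) : Prop where
  measurable : Measurable ζ
  nonneg : 0 ≤ K
  mean : ∀ θ : EuclideanSpace ℝ ι, ∫ a, inner ℝ θ (ζ a) ∂μ = 0
  moments : ∀ θ : EuclideanSpace ℝ ι, SubExpMoments μ (fun a => inner ℝ θ (ζ a)) (K * ‖θ‖)

/-- The sum of `ζ (x i)` over the indices selected by `c`. -/
noncomputable def selectSum {α ι : Type*} [Fintype ι] {n : ℕ}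
    (ζ : α → EuclideanSpace ℝ ι) (c : Fin n → Bool) (x : Fin n → α) : EuclideanSpace ℝ ι :=
  ∑ i, (if c i then (1 : ℝ) else 0) • ζ (x i)

theorem inner_selectSum {α ι : Type*} [Fintype ι] {n : ℕ}
    (ζ : α → EuclideanSpace ℝ ι) (c : Fin n → Bool) (x : Fin n → α) (θ : EuclideanSpace ℝ ι) :
    inner ℝ θ (selectSum ζ c x) = ∑ i, (if c i then (1 : ℝ) else 0) * inner ℝ θ (ζ (x i)) := by
  simp only [selectSum, inner_sum, inner_smul_right]

section

variable {α ι : Type*} [MeasurableSpace α] [Fintype ι] {μ : Measure α} [IsProbabilityMeasure μ]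
  {ζ : α → EuclideanSpace ℝ ι} {K : ℝ} {n : ℕ}

theorem measurable_selectSum (hζ : Measurable ζ) (c : Fin n → Bool) :
    Measurable (selectSum ζ c) :=
  Finset.measurable_sum _ fun i _ => (hζ.comp (measurable_pi_apply i)).const_smul
    (if c i then (1 : ℝ) else 0)

theorem CenteredSubExpVec.lintegral_inner_pow_le (h : CenteredSubExpVec μ ζ K) (hn : 1 ≤ n)
    (c : Fin n → Bool) (m : ℕ) (θ : EuclideanSpace ℝ ι) :
    ∫⁻ x, ENNReal.ofReal (inner ℝ θ (selectSum ζ c x) ^ (2 * m))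
        ∂(Measure.pi fun _ : Fin n => μ) ≤
      ENNReal.ofReal (4 * (12 * m * (K * ‖θ‖) * Real.sqrt n) ^ (2 * m)) := by
  simp only [inner_selectSum]
  refine (h.moments θ).lintegral_sum_pow_le (h.mean θ) hn _ (fun i => ?_) m
  split_ifs <;> simp

/-- Even moments of the norm of a selected sum: the power mean inequality reduces them to the
coordinates, at the price of a factor `d ^ m`. -/
theorem CenteredSubExpVec.lintegral_norm_pow_le [Nonempty ι] (h : CenteredSubExpVec μ ζ K)
    (hn : 1 ≤ n) (c : Fin n → Bool) {m : ℕ} (hm : 1 ≤ m) :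
    ∫⁻ x, ENNReal.ofReal (‖selectSum ζ c x‖ ^ (2 * m)) ∂(Measure.pi fun _ : Fin n => μ) ≤
      ENNReal.ofReal (4 * (12 * m * K * Real.sqrt n) ^ (2 * m) * Fintype.card ι ^ m) := by
  classical
  obtain ⟨k, rfl⟩ : ∃ k, m = k + 1 := ⟨m - 1, by omega⟩
  have hK := h.nonneg
  have hd : (0 : ℝ) < Fintype.card ι := by exact_mod_cast Fintype.card_pos
  have hpt (v : EuclideanSpace ℝ ι) : ‖v‖ ^ (2 * (k + 1)) ≤
      ∑ j, (Fintype.card ι : ℝ) ^ k *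
        inner ℝ (EuclideanSpace.single j (1 : ℝ)) v ^ (2 * (k + 1)) := by
    have h1 := pow_sum_div_card_le_sum_pow (s := (Finset.univ : Finset ι))
      (f := fun j => (v j) ^ 2) (fun j _ => sq_nonneg _) k
    rw [div_le_iff₀ (by simpa using pow_pos hd k)] at h1
    rw [pow_mul, EuclideanSpace.real_norm_sq_eq]
    refine h1.trans (le_of_eq ?_)
    rw [Finset.sum_mul]
    refine Finset.sum_congr rfl fun j _ => ?_
    rw [EuclideanSpace.inner_single_left, pow_mul]
    simp [mul_comm]
  calc _ ≤ ∫⁻ x, ∑ j, ENNReal.ofReal ((Fintype.card ι : ℝ) ^ k) *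
        ENNReal.ofReal (inner ℝ (EuclideanSpace.single j (1 : ℝ)) (selectSum ζ c x) ^
          (2 * (k + 1))) ∂(Measure.pi fun _ : Fin n => μ) := by
        refine lintegral_mono fun x => ?_
        refine (ENNReal.ofReal_le_ofReal (hpt _)).trans (le_of_eq ?_)
        rw [ENNReal.ofReal_sum_of_nonneg fun j _ =>
          mul_nonneg (by positivity) ((even_two_mul _).pow_nonneg _)]
        refine Finset.sum_congr rfl fun j _ => ?_
        rw [ENNReal.ofReal_mul (by positivity)]
    _ = ∑ j, ENNReal.ofReal ((Fintype.card ι : ℝ) ^ k) * ∫⁻ x,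
        ENNReal.ofReal (inner ℝ (EuclideanSpace.single j (1 : ℝ)) (selectSum ζ c x) ^
          (2 * (k + 1))) ∂(Measure.pi fun _ : Fin n => μ) := by
        have hmj (j : ι) : Measurable fun x : Fin n → α => ENNReal.ofReal
            (inner ℝ (EuclideanSpace.single j (1 : ℝ)) (selectSum ζ c x) ^ (2 * (k + 1))) :=
          ((measurable_const.inner (measurable_selectSum h.measurable c)).pow_const
            _).ennreal_ofReal
        rw [lintegral_finsetSum _ fun j _ => (hmj j).const_mul _]
        exact Finset.sum_congr rfl fun j _ => lintegral_const_mul _ (hmj j)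
    _ ≤ ∑ _j : ι, ENNReal.ofReal ((Fintype.card ι : ℝ) ^ k) *
          ENNReal.ofReal (4 * (12 * (k + 1 : ℕ) * K * Real.sqrt n) ^ (2 * (k + 1))) := by
        refine Finset.sum_le_sum fun j _ => ?_
        gcongr
        simpa using h.lintegral_inner_pow_le hn c (k + 1) (EuclideanSpace.single j (1 : ℝ))
    _ = _ := by
        rw [Finset.sum_const, Finset.card_univ, nsmul_eq_mul, ← ENNReal.ofReal_mul (by positivity),
          ← ENNReal.ofReal_natCast, ← ENNReal.ofReal_mul (by positivity)]
        congr 1; ring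

/-- Sums over complementary parts of an i.i.d. sample are independent. -/
theorem indepFun_selectSum (hζ : Measurable ζ) (c : Fin n → Bool) :
    ProbabilityTheory.IndepFun (selectSum ζ fun i => !c i) (selectSum ζ c)
      (Measure.pi fun _ : Fin n => μ) := by
  classical
  have hi : ProbabilityTheory.iIndepFun (fun (i : Fin n) (x : Fin n → α) => ζ (x i))
      (Measure.pi fun _ : Fin n => μ) :=
    ProbabilityTheory.iIndepFun_pi (X := fun _ : Fin n => ζ) fun _ => hζ.aemeasurable
  have hsel (c : Fin n → Bool) : selectSum ζ c =
      (fun v : (Finset.univ.filter fun i => c i = true) → EuclideanSpace ℝ ι => ∑ i, v i) ∘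
        fun x i => ζ (x i) := by
    funext x
    simp only [selectSum, Function.comp, ite_smul, one_smul, zero_smul]
    rw [← Finset.sum_filter]
    exact (Finset.sum_coe_sort _ fun i => ζ (x i)).symm
  rw [hsel c, hsel fun i => !c i]
  refine (hi.indepFun_finset _ _ ?_ fun i => hζ.comp (measurable_pi_apply i)).comp ?_ ?_
  · rw [Finset.disjoint_filter]; intro i _ h; simpa using h
  · exact Finset.measurable_sum _ fun i _ => measurable_pi_apply i
  · exact Finset.measurable_sum _ fun i _ => measurable_pi_apply i

theorem lintegral_comp_of_indepFun {Ω β γ : Type*} [MeasurableSpace Ω] [MeasurableSpace β]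
    [MeasurableSpace γ] {P : Measure Ω} [IsProbabilityMeasure P] {f : Ω → β} {g : Ω → γ}
    (hfg : ProbabilityTheory.IndepFun f g P) (hf : Measurable f) (hg : Measurable g)
    {F : β × γ → ℝ≥0∞} (hF : Measurable F) :
    ∫⁻ x, F (f x, g x) ∂P = ∫⁻ x, ∫⁻ y, F (f x, g y) ∂P ∂P := by
  rw [← lintegral_map hF (hf.prodMk hg), (ProbabilityTheory.indepFun_iff_map_prod_eq_prod_map_map
    hf.aemeasurable hg.aemeasurable).1 hfg, lintegral_prod _ hF.aemeasurable,
    lintegral_map hF.lintegral_prod_right' hf]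
  exact lintegral_congr fun x => lintegral_map (hF.comp measurable_prodMk_left) hg

/-- Even moments of the decoupled bilinear form: conditionally on one half of the sample the form
is a linear statistic of the other half. -/
theorem CenteredSubExpVec.lintegral_decoupled_pow_le [Nonempty ι] (h : CenteredSubExpVec μ ζ K)
    (hn : 1 ≤ n) (c : Fin n → Bool) {m : ℕ} (hm : 1 ≤ m)
    (Q : EuclideanSpace ℝ ι →L[ℝ] EuclideanSpace ℝ ι) :
    ∫⁻ x, ENNReal.ofReal (inner ℝ (Q (selectSum ζ (fun i => !c i) x)) (selectSum ζ c x) ^ (2 * m))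
        ∂(Measure.pi fun _ : Fin n => μ) ≤
      ENNReal.ofReal (16 * ((12 * m * K * Real.sqrt n) ^ 2 * ‖Q‖ *
        Real.sqrt (Fintype.card ι)) ^ (2 * m)) := by
  have hK := h.nonneg
  have hm1 := measurable_selectSum (n := n) h.measurable (fun i => !c i)
  have hm2 := measurable_selectSum (n := n) h.measurable c
  have hF : Measurable fun p : EuclideanSpace ℝ ι × EuclideanSpace ℝ ι =>
      ENNReal.ofReal (inner ℝ (Q p.1) p.2 ^ (2 * m)) :=
    (((Q.continuous.comp continuous_fst).inner continuous_snd).measurable.pow_const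
      _).ennreal_ofReal
  rw [lintegral_comp_of_indepFun (indepFun_selectSum h.measurable c) hm1 hm2 hF]
  set B := 12 * m * K * Real.sqrt n with hB
  have hB0 : 0 ≤ B := by positivity
  have hv (v : EuclideanSpace ℝ ι) : 4 * (12 * m * (K * ‖Q v‖) * Real.sqrt n) ^ (2 * m) ≤
      4 * (B * ‖Q‖) ^ (2 * m) * ‖v‖ ^ (2 * m) := by
    calc 4 * (12 * m * (K * ‖Q v‖) * Real.sqrt n) ^ (2 * m)
        = 4 * (B * ‖Q v‖) ^ (2 * m) := by rw [hB]; ring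
      _ ≤ 4 * (B * (‖Q‖ * ‖v‖)) ^ (2 * m) := by gcongr; exact Q.le_opNorm v
      _ = _ := by rw [← mul_assoc B, mul_pow _ ‖v‖, ← mul_assoc (4 : ℝ)]
  calc _ ≤ ∫⁻ x, ENNReal.ofReal (4 * (B * ‖Q‖) ^ (2 * m)) *
        ENNReal.ofReal (‖selectSum ζ (fun i => !c i) x‖ ^ (2 * m))
          ∂(Measure.pi fun _ : Fin n => μ) := by
        refine lintegral_mono fun x => ?_
        dsimp only
        rw [← ENNReal.ofReal_mul (by positivity)]
        exact (h.lintegral_inner_pow_le hn c m (Q (selectSum ζ (fun i => !c i) x))).trans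
          (ENNReal.ofReal_le_ofReal (hv _))
    _ = ENNReal.ofReal (4 * (B * ‖Q‖) ^ (2 * m)) * ∫⁻ x,
        ENNReal.ofReal (‖selectSum ζ (fun i => !c i) x‖ ^ (2 * m))
          ∂(Measure.pi fun _ : Fin n => μ) :=
        lintegral_const_mul _ (hm1.norm.pow_const _).ennreal_ofReal
    _ ≤ ENNReal.ofReal (4 * (B * ‖Q‖) ^ (2 * m)) *
        ENNReal.ofReal (4 * B ^ (2 * m) * Fintype.card ι ^ m) := by
        gcongr; exact h.lintegral_norm_pow_le hn _ hm
    _ = _ := by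
        rw [← ENNReal.ofReal_mul (by positivity)]
        congr 1
        have : (Fintype.card ι : ℝ) ^ m = Real.sqrt (Fintype.card ι) ^ (2 * m) := by
          rw [pow_mul, Real.sq_sqrt (by positivity)]
        rw [this]
        clear_value B
        ring

end

/-- A quarter of all splittings put `s` in the first half and `t` in the second. -/
theorem sum_bool_select_mul_not {n : ℕ} {s t : Fin n} (hst : s ≠ t) :
    ∑ c : Fin n → Bool, (if c s then (1 : ℝ) else 0) * (if !c t then (1 : ℝ) else 0) =
      2 ^ n / 4 := by
  classical
  -- The summand is a product of one factor per coordinate.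
  let g : Fin n → Bool → ℝ := fun i b =>
    if i = s then (if b then 1 else 0) else if i = t then (if !b then 1 else 0) else 1
  have h1 (c : Fin n → Bool) : (if c s then (1 : ℝ) else 0) * (if !c t then (1 : ℝ) else 0) =
      ∏ i, g i (c i) := by
    rw [← Finset.mul_prod_erase _ _ (Finset.mem_univ s),
      ← Finset.mul_prod_erase _ _ (Finset.mem_erase.2 ⟨hst.symm, Finset.mem_univ t⟩),
      Finset.prod_eq_one (s := (Finset.univ.erase s).erase t)]
    · simp [g, hst.symm]
    · intro i hi
      simp only [Finset.mem_erase, Finset.mem_univ, and_true] at hi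
      simp [g, hi.1, hi.2]
  simp only [h1]
  have h2 := Finset.prod_univ_sum (fun _ : Fin n => (Finset.univ : Finset Bool)) g
  rw [Fintype.piFinset_univ] at h2
  rw [← h2, ← Finset.mul_prod_erase _ _ (Finset.mem_univ s),
      ← Finset.mul_prod_erase _ _ (Finset.mem_erase.2 ⟨hst.symm, Finset.mem_univ t⟩)]
  have h3 : ∏ i ∈ (Finset.univ.erase s).erase t, ∑ b, g i b = 2 ^ (n - 2) := by
    rw [Finset.prod_congr rfl (g := fun _ => (2 : ℝ))]
    · rw [Finset.prod_const, Finset.card_erase_of_mem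
        (Finset.mem_erase.2 ⟨hst.symm, Finset.mem_univ t⟩),
        Finset.card_erase_of_mem (Finset.mem_univ s), Finset.card_univ, Fintype.card_fin]
      rfl
    · intro i hi
      simp only [Finset.mem_erase, Finset.mem_univ, and_true] at hi
      simp [g, hi.1, hi.2]
  have hn : 2 ≤ n := by
    have := s.2; have := t.2
    have : (s : ℕ) ≠ t := fun h => hst (Fin.ext h)
    omega
  rw [h3]
  obtain ⟨k, rfl⟩ : ∃ k, n = k + 2 := ⟨n - 2, by omega⟩
  simp [g, hst.symm, pow_add]
  ring

/-- Random-partition decoupling: the off-diagonal form is four times the average, over all ways of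
splitting the sample in two, of the form between the two halves. -/
theorem offDiag_eq_average {α ι : Type*} [Fintype ι] {n : ℕ}
    (ζ : α → EuclideanSpace ℝ ι) (Q : EuclideanSpace ℝ ι →L[ℝ] EuclideanSpace ℝ ι)
    (x : Fin n → α) :
    ∑ s, ∑ t ∈ Finset.univ.erase s, inner ℝ (Q (ζ (x t))) (ζ (x s)) =
      ∑ c : Fin n → Bool, (1 / 2 ^ n) *
        (4 * inner ℝ (Q (selectSum ζ (fun i => !c i) x)) (selectSum ζ c x)) := by
  have h1 (c : Fin n → Bool) : inner ℝ (Q (selectSum ζ (fun i => !c i) x)) (selectSum ζ c x) =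
      ∑ s, ∑ t, ((if c s then (1 : ℝ) else 0) * (if !c t then (1 : ℝ) else 0)) *
        inner ℝ (Q (ζ (x t))) (ζ (x s)) := by
    rw [inner_selectSum]
    refine Finset.sum_congr rfl fun s _ => ?_
    rw [selectSum, map_sum, sum_inner, Finset.mul_sum]
    refine Finset.sum_congr rfl fun t _ => ?_
    rw [map_smul, real_inner_smul_left, mul_assoc]
  simp only [h1, Finset.mul_sum]
  rw [Finset.sum_comm]
  refine Finset.sum_congr rfl fun s _ => ?_
  rw [Finset.sum_comm, ← Finset.add_sum_erase _ _ (Finset.mem_univ s)]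
  have hz : ∑ c : Fin n → Bool, (1 / 2 ^ n : ℝ) * (4 * ((if c s then (1 : ℝ) else 0) *
      (if !c s then (1 : ℝ) else 0) * inner ℝ (Q (ζ (x s))) (ζ (x s)))) = 0 := by
    refine Finset.sum_eq_zero fun c _ => ?_
    cases c s <;> simp
  rw [hz, zero_add]
  refine Finset.sum_congr rfl fun t ht => ?_
  have hst : s ≠ t := (Finset.ne_of_mem_erase ht).symm
  simp only [← mul_assoc, ← Finset.sum_mul]
  simp only [mul_assoc, ← Finset.mul_sum]
  rw [← mul_assoc 4, ← mul_assoc (1 / 2 ^ n : ℝ)]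
  have := sum_bool_select_mul_not hst
  rw [this]
  field_simp

/-- Even moments of the degenerate part of the U-statistic. -/
theorem CenteredSubExpVec.lintegral_offDiag_pow_le {α ι : Type*} [MeasurableSpace α] [Fintype ι]
    [Nonempty ι] {μ : Measure α} [IsProbabilityMeasure μ] {ζ : α → EuclideanSpace ℝ ι} {K : ℝ}
    {n : ℕ} (h : CenteredSubExpVec μ ζ K) (hn : 1 ≤ n) {m : ℕ} (hm : 1 ≤ m)
    (Q : EuclideanSpace ℝ ι →L[ℝ] EuclideanSpace ℝ ι) :
    ∫⁻ x, ENNReal.ofReal ((∑ s, ∑ t ∈ Finset.univ.erase s,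
        inner ℝ (Q (ζ (x t))) (ζ (x s))) ^ (2 * m)) ∂(Measure.pi fun _ : Fin n => μ) ≤
      ENNReal.ofReal (16 * (4 * ((12 * m * K * Real.sqrt n) ^ 2 * ‖Q‖ *
        Real.sqrt (Fintype.card ι))) ^ (2 * m)) := by
  set B := (12 * m * K * Real.sqrt n) ^ 2 * ‖Q‖ * Real.sqrt (Fintype.card ι) with hB
  have hK := h.nonneg
  have hB0 : 0 ≤ B := by positivity
  have hcard : ∑ _c : Fin n → Bool, (1 / 2 ^ n : ℝ) = 1 := by
    simp [Finset.card_univ]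
  have hwm (c : Fin n → Bool) : Measurable fun x : Fin n → α => ENNReal.ofReal
      (inner ℝ (Q (selectSum ζ (fun i => !c i) x)) (selectSum ζ c x) ^ (2 * m)) :=
    (((Q.continuous.measurable.comp (measurable_selectSum h.measurable _)).inner
      (measurable_selectSum h.measurable c)).pow_const _).ennreal_ofReal
  calc _ ≤ ∫⁻ x, ∑ c : Fin n → Bool, ENNReal.ofReal (1 / 2 ^ n * 4 ^ (2 * m)) *
        ENNReal.ofReal (inner ℝ (Q (selectSum ζ (fun i => !c i) x)) (selectSum ζ c x) ^ (2 * m))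
        ∂(Measure.pi fun _ : Fin n => μ) := by
        refine lintegral_mono fun x => ?_
        simp only [offDiag_eq_average]
        refine (ENNReal.ofReal_le_ofReal (Real.pow_arith_mean_le_arith_mean_pow_of_even _ _ _
          (fun _ _ => by positivity) hcard (even_two_mul m))).trans (le_of_eq ?_)
        rw [ENNReal.ofReal_sum_of_nonneg fun j _ =>
          mul_nonneg (by positivity) ((even_two_mul _).pow_nonneg _)]
        refine Finset.sum_congr rfl fun c _ => ?_
        rw [← ENNReal.ofReal_mul (by positivity), mul_pow (4 : ℝ), mul_assoc]
    _ = ∑ c : Fin n → Bool, ENNReal.ofReal (1 / 2 ^ n * 4 ^ (2 * m)) *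
        ∫⁻ x, ENNReal.ofReal
          (inner ℝ (Q (selectSum ζ (fun i => !c i) x)) (selectSum ζ c x) ^ (2 * m))
        ∂(Measure.pi fun _ : Fin n => μ) := by
        rw [lintegral_finsetSum _ fun c _ => (hwm c).const_mul _]
        exact Finset.sum_congr rfl fun c _ => lintegral_const_mul _ (hwm c)
    _ ≤ ∑ _c : Fin n → Bool, ENNReal.ofReal (1 / 2 ^ n * 4 ^ (2 * m)) *
        ENNReal.ofReal (16 * B ^ (2 * m)) := by
        refine Finset.sum_le_sum fun c _ => ?_
        gcongr
        exact h.lintegral_decoupled_pow_le hn c hm Q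
    _ = _ := by
        simp only [← ENNReal.ofReal_mul (show (0 : ℝ) ≤ 1 / 2 ^ n * 4 ^ (2 * m) by positivity)]
        rw [← ENNReal.ofReal_sum_of_nonneg fun _ _ => by positivity]
        congr 1
        rw [← Finset.sum_mul, ← Finset.sum_mul, hcard, mul_pow 4 B]
        ring

/-! ### Concentration of the U-statistic -/

theorem two_mul_sum_sum_Ioi {n : ℕ} (g : Fin n → Fin n → ℝ) (hg : ∀ s t, g s t = g t s) :
    2 * ∑ s, ∑ t ∈ Finset.Ioi s, g s t = ∑ s, ∑ t ∈ Finset.univ.erase s, g s t := by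
  have h1 (s : Fin n) : ∑ t ∈ Finset.univ.erase s, g s t =
      ∑ t ∈ Finset.Ioi s, g s t + ∑ t ∈ Finset.Iio s, g s t := by
    rw [← Finset.sum_union]
    · refine Finset.sum_congr ?_ fun _ _ => rfl
      ext t
      simp only [Finset.mem_erase, Finset.mem_univ, and_true, Finset.mem_union, Finset.mem_Ioi,
        Finset.mem_Iio]
      rw [ne_comm, ne_iff_lt_or_gt]
    · rw [Finset.disjoint_left]
      intro t h h'
      exact lt_asymm (Finset.mem_Ioi.1 h) (Finset.mem_Iio.1 h')
  -- Exchanging the order of summation turns pairs `t < s` into pairs `s < t`.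
  have h2 : ∑ s, ∑ t ∈ Finset.Iio s, g s t = ∑ s, ∑ t ∈ Finset.Ioi s, g s t := by
    rw [Finset.sum_comm' (t' := Finset.univ) (s' := fun t => Finset.Ioi t)]
    · exact Finset.sum_congr rfl fun s _ => Finset.sum_congr rfl fun t _ => hg _ _
    · intro s t; simp
  simp only [h1, Finset.sum_add_distrib, h2]
  ring

/-- Hoeffding decomposition of the U-statistic with kernel `⟨A u, A v⟩`. -/
theorem uStat_eq {α ι : Type*} [Fintype ι] {n : ℕ} (hn : 2 ≤ n)
    (ζ : α → EuclideanSpace ℝ ι) (b : EuclideanSpace ℝ ι)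
    (A : EuclideanSpace ℝ ι →L[ℝ] EuclideanSpace ℝ ι) (x : Fin n → α) :
    (1 / (n.choose 2 : ℝ)) * ∑ s, ∑ t ∈ Finset.Ioi s,
        inner ℝ (A (ζ (x s) + b)) (A (ζ (x t) + b)) - ‖A b‖ ^ 2 =
      1 / ((n : ℝ) * (n - 1)) * ∑ s, ∑ t ∈ Finset.univ.erase s,
        inner ℝ ((ContinuousLinearMap.adjoint A ∘SL A) (ζ (x t))) (ζ (x s)) +
      2 / n * inner ℝ (ContinuousLinearMap.adjoint A (A b)) (selectSum ζ (fun _ => true) x) := by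
  have hn' : (2 : ℝ) ≤ n := by exact_mod_cast hn
  set V := ∑ s, inner ℝ (A b) (A (ζ (x s))) with hV
  have hV' : inner ℝ (ContinuousLinearMap.adjoint A (A b)) (selectSum ζ (fun _ => true) x) = V := by
    rw [inner_selectSum]
    simp [ContinuousLinearMap.adjoint_inner_left, hV]
  have hpt (s : Fin n) : ∑ t ∈ Finset.univ.erase s, inner ℝ (A (ζ (x s) + b)) (A (ζ (x t) + b)) =
      ∑ t ∈ Finset.univ.erase s,
        inner ℝ ((ContinuousLinearMap.adjoint A ∘SL A) (ζ (x t))) (ζ (x s)) +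
      ((n - 1) * inner ℝ (A b) (A (ζ (x s))) + (V - inner ℝ (A b) (A (ζ (x s)))) +
        (n - 1) * ‖A b‖ ^ 2) := by
    have e (t : Fin n) : inner ℝ (A (ζ (x s) + b)) (A (ζ (x t) + b)) =
        inner ℝ ((ContinuousLinearMap.adjoint A ∘SL A) (ζ (x t))) (ζ (x s)) +
        (inner ℝ (A b) (A (ζ (x s))) + inner ℝ (A b) (A (ζ (x t))) + ‖A b‖ ^ 2) := by
      simp only [map_add, inner_add_left, inner_add_right, ContinuousLinearMap.comp_apply,
        ContinuousLinearMap.adjoint_inner_left, real_inner_self_eq_norm_sq]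
      rw [real_inner_comm (A (ζ (x s))) (A (ζ (x t))), real_inner_comm (A (ζ (x s))) (A b)]
      ring
    have hc : ((Finset.univ.erase s).card : ℝ) = n - 1 := by
      rw [Finset.card_erase_of_mem (Finset.mem_univ s), Finset.card_univ, Fintype.card_fin,
        Nat.cast_sub (by omega), Nat.cast_one]
    have hVs : ∑ t ∈ Finset.univ.erase s, inner ℝ (A b) (A (ζ (x t))) =
        V - inner ℝ (A b) (A (ζ (x s))) := by
      rw [hV, ← Finset.add_sum_erase _ _ (Finset.mem_univ s)]; ring
    simp only [e, Finset.sum_add_distrib, Finset.sum_const, nsmul_eq_mul, hc, hVs]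
  have hsum : 2 * ∑ s, ∑ t ∈ Finset.Ioi s, inner ℝ (A (ζ (x s) + b)) (A (ζ (x t) + b)) =
      ∑ s, ∑ t ∈ Finset.univ.erase s,
        inner ℝ ((ContinuousLinearMap.adjoint A ∘SL A) (ζ (x t))) (ζ (x s)) +
      (2 * (n - 1) * V + n * (n - 1) * ‖A b‖ ^ 2) := by
    rw [two_mul_sum_sum_Ioi _ fun s t => real_inner_comm _ _]
    simp only [hpt, Finset.sum_add_distrib, Finset.sum_sub_distrib, ← Finset.mul_sum, ← hV,
      Finset.sum_const, Finset.card_univ, Fintype.card_fin, nsmul_eq_mul]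
    ring
  have hn1 : (n : ℝ) - 1 ≠ 0 := by linarith
  have hn0 : (n : ℝ) ≠ 0 := by linarith
  rw [hV', Nat.cast_choose_two]
  generalize (∑ s, ∑ t ∈ Finset.Ioi s, inner ℝ (A (ζ (x s) + b)) (A (ζ (x t) + b))) = W at hsum
  have : W = (2 * W) / 2 := by ring
  rw [this, hsum]
  field_simp
  ring

/-- Concentration of the U-statistic with kernel `⟨A u, A v⟩`: the linear and the degenerate part
of its Hoeffding decomposition are controlled separately by Markov's inequality. -/
theorem CenteredSubExpVec.uStat_concentration {α ι : Type*} [MeasurableSpace α] [Fintype ι]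
    [Nonempty ι] {μ : Measure α} [IsProbabilityMeasure μ] {ζ : α → EuclideanSpace ℝ ι} {K : ℝ}
    (h : CenteredSubExpVec μ ζ K) {n : ℕ} (hn : 2 ≤ n) {m : ℕ} (hm : 1 ≤ m)
    (b : EuclideanSpace ℝ ι) (A : EuclideanSpace ℝ ι →L[ℝ] EuclideanSpace ℝ ι) :
    1 - 20 * Real.exp (-(2 * m)) ≤ (Measure.pi fun _ : Fin n => μ).real
      {x | |(1 / (n.choose 2 : ℝ)) * ∑ s, ∑ t ∈ Finset.Ioi s,
          inner ℝ (A (ζ (x s) + b)) (A (ζ (x t) + b)) - ‖A b‖ ^ 2| ≤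
        72 * (m * K * ‖A‖ / Real.sqrt n) * ‖A b‖ +
          3456 * ((m * K * ‖A‖) ^ 2 * Real.sqrt (Fintype.card ι) / n)} := by
  have hK := h.nonneg
  have hn1 : 1 ≤ n := by omega
  have hn' : (2 : ℝ) ≤ n := by exact_mod_cast hn
  have hsn : 0 < Real.sqrt n := Real.sqrt_pos.2 (by linarith)
  have he : Real.exp 1 ≤ 3 := by linarith [Real.exp_one_lt_d9]
  set P := Measure.pi fun _ : Fin n => μ with hP
  set Q := ContinuousLinearMap.adjoint A ∘SL A with hQ
  have hQn : ‖Q‖ = ‖A‖ * ‖A‖ := ContinuousLinearMap.norm_adjoint_comp_self A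
  set θ := ContinuousLinearMap.adjoint A (A b) with hθ
  have hθn : ‖θ‖ ≤ ‖A‖ * ‖A b‖ := by
    refine (ContinuousLinearMap.le_opNorm _ _).trans (le_of_eq ?_)
    rw [LinearIsometryEquiv.norm_map]
  let T : (Fin n → α) → ℝ := fun x =>
    ∑ s, ∑ t ∈ Finset.univ.erase s, inner ℝ (Q (ζ (x t))) (ζ (x s))
  let V : (Fin n → α) → ℝ := fun x => inner ℝ θ (selectSum ζ (fun _ => true) x)
  have hζ (s : Fin n) : Measurable fun x : Fin n → α => ζ (x s) :=
    h.measurable.comp (measurable_pi_apply s)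
  have hTm : Measurable T := Finset.measurable_sum _ fun s _ => Finset.measurable_sum _ fun t _ =>
    (Q.continuous.measurable.comp (hζ t)).inner (hζ s)
  have hVm : Measurable V := measurable_const.inner (measurable_selectSum h.measurable _)
  set BT := 4 * ((12 * m * K * Real.sqrt n) ^ 2 * ‖Q‖ * Real.sqrt (Fintype.card ι)) with hBT
  set BV := 12 * m * (K * ‖θ‖) * Real.sqrt n with hBV
  have hBT0 : 0 ≤ BT := by positivity
  have hBV0 : 0 ≤ BV := by positivity
  have tT := measure_gt_le_of_lintegral_pow_le (P := P) hTm hm hBT0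
    (h.lintegral_offDiag_pow_le hn1 hm Q)
  have tV := measure_gt_le_of_lintegral_pow_le (P := P) hVm hm hBV0
    (h.lintegral_inner_pow_le hn1 (fun _ => true) m θ)
  set G := {x : Fin n → α | |(1 / (n.choose 2 : ℝ)) * ∑ s, ∑ t ∈ Finset.Ioi s,
          inner ℝ (A (ζ (x s) + b)) (A (ζ (x t) + b)) - ‖A b‖ ^ 2| ≤
        72 * (m * K * ‖A‖ / Real.sqrt n) * ‖A b‖ +
          3456 * ((m * K * ‖A‖) ^ 2 * Real.sqrt (Fintype.card ι) / n)} with hG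
  have hcover : Set.univ ⊆ G ∪ ({x | Real.exp 1 * BT < |T x|} ∪ {x | Real.exp 1 * BV < |V x|}) := by
    intro x _
    by_cases hx1 : Real.exp 1 * BT < |T x|
    · exact Or.inr (Or.inl hx1)
    by_cases hx2 : Real.exp 1 * BV < |V x|
    · exact Or.inr (Or.inr hx2)
    left
    rw [not_lt] at hx1 hx2
    rw [hG, Set.mem_ofPred_eq, uStat_eq hn]
    have hss : Real.sqrt n ^ 2 = n := Real.sq_sqrt (by positivity)
    have bT : |1 / ((n : ℝ) * (n - 1)) * T x| ≤
        3456 * ((m * K * ‖A‖) ^ 2 * Real.sqrt (Fintype.card ι) / n) := by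
      have hpos : 0 < (n : ℝ) * (n - 1) := by nlinarith
      rw [abs_mul, abs_of_pos (by positivity)]
      calc 1 / ((n : ℝ) * (n - 1)) * |T x| ≤ 1 / ((n : ℝ) * (n / 2)) * (3 * BT) := by
            gcongr
            · linarith
            · exact hx1.trans (by gcongr)
        _ = _ := by
            rw [hBT, hQn, mul_pow _ (Real.sqrt n), hss]
            field_simp
            ring
    have bV : |2 / (n : ℝ) * V x| ≤ 72 * (m * K * ‖A‖ / Real.sqrt n) * ‖A b‖ := by
      rw [abs_mul, abs_of_pos (by positivity)]
      calc 2 / (n : ℝ) * |V x|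
          ≤ 2 / (n : ℝ) * (3 * (12 * m * (K * (‖A‖ * ‖A b‖)) * Real.sqrt n)) := by
            gcongr
            refine hx2.trans ?_
            rw [hBV]
            gcongr
        _ = _ := by
            nth_rewrite 1 [← hss]
            field_simp
            ring
    exact (abs_add_le _ _).trans (by rw [add_comm]; exact add_le_add bV bT)
  have hle : 1 ≤ P G + ENNReal.ofReal (20 * Real.exp (-(2 * m))) := by
    calc (1 : ℝ≥0∞) = P Set.univ := measure_univ.symm
      _ ≤ P G + (ENNReal.ofReal (16 * Real.exp (-(2 * m))) +
            ENNReal.ofReal (4 * Real.exp (-(2 * m)))) :=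
          (measure_mono hcover).trans ((measure_union_le _ _).trans
            (add_le_add le_rfl ((measure_union_le _ _).trans (add_le_add tT tV))))
      _ = _ := by
          rw [← ENNReal.ofReal_add (by positivity) (by positivity)]
          congr 2; ring
  have hreal := ENNReal.toReal_mono
    (ENNReal.add_ne_top.2 ⟨measure_ne_top P G, ENNReal.ofReal_ne_top⟩) hle
  rw [ENNReal.toReal_add (measure_ne_top _ _) ENNReal.ofReal_ne_top, ENNReal.toReal_one,
    ENNReal.toReal_ofReal (by positivity)] at hreal
  rw [Measure.real]
  linarith

/-! ### Moments of the product of sub-Gaussian variables -/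

theorem SubExpMoments.of_eLpNorm_le {α : Type*} [MeasurableSpace α] {μ : Measure α} {X : α → ℝ}
    {K : ℝ} (hX : Measurable X) (hK : 0 ≤ K)
    (h : ∀ k : ℕ, 1 ≤ k → eLpNorm X k μ ≤ ENNReal.ofReal (k * K)) : SubExpMoments μ X K := by
  have hmem (k : ℕ) (hk : 1 ≤ k) : MemLp X k μ :=
    ⟨hX.aestronglyMeasurable, (h k hk).trans_lt ENNReal.ofReal_lt_top⟩
  refine ⟨hX, hK, fun k hk => ?_, fun k hk => ?_⟩
  · simpa using (hmem k hk).integrable_norm_pow (by omega)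
  · have h1 := h k hk
    have hk0 : (k : ℝ) ≠ 0 := by positivity
    rw [(hmem k hk).eLpNorm_eq_integral_rpow_norm (by simpa using (by omega : k ≠ 0)) (by simp),
      ENNReal.ofReal_le_ofReal_iff (by positivity)] at h1
    simp only [ENNReal.toReal_natCast, Real.rpow_natCast, Real.norm_eq_abs] at h1
    have hI : 0 ≤ ∫ a, |X a| ^ k ∂μ := integral_nonneg fun a => by positivity
    calc ∫ a, |X a| ^ k ∂μ = ((∫ a, |X a| ^ k ∂μ) ^ ((k : ℝ)⁻¹)) ^ k := by
          rw [Real.rpow_inv_natCast_pow hI (by omega)]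
      _ ≤ (k * K) ^ k := by gcongr

theorem IsSubG.eLpNorm_le {Ω : Type*} [MeasurableSpace Ω] {P : Measure Ω} {z : Ω → ℝ} {σ : ℝ}
    (h : IsSubG P z σ) {p : ℝ} (hp : 1 ≤ p) :
    eLpNorm z (ENNReal.ofReal p) P ≤ ENNReal.ofReal (Real.sqrt p * σ) := by
  have h1 := h p hp
  have hs : 0 < Real.sqrt p := Real.sqrt_pos.2 (by linarith)
  have hp' : p ^ (-(1 / 2) : ℝ) = (Real.sqrt p)⁻¹ := by
    rw [Real.rpow_neg (by linarith), Real.sqrt_eq_rpow]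
  rw [hp'] at h1
  calc eLpNorm z (ENNReal.ofReal p) P
      = ENNReal.ofReal (Real.sqrt p) *
          (ENNReal.ofReal (Real.sqrt p)⁻¹ * eLpNorm z (ENNReal.ofReal p) P) := by
        rw [← mul_assoc, ← ENNReal.ofReal_mul hs.le, mul_inv_cancel₀ hs.ne', ENNReal.ofReal_one,
          one_mul]
    _ ≤ ENNReal.ofReal (Real.sqrt p) * ENNReal.ofReal σ := by gcongr
    _ = _ := (ENNReal.ofReal_mul hs.le).symm

theorem IsSubGVec.eLpNorm_inner_le {Ω ι : Type*} [MeasurableSpace Ω] [Fintype ι] {P : Measure Ω}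
    {z : Ω → EuclideanSpace ℝ ι} {τ : ℝ} (h : IsSubGVec P z τ) (θ : EuclideanSpace ℝ ι) {p : ℝ}
    (hp : 1 ≤ p) :
    eLpNorm (fun ω => inner ℝ θ (z ω)) (ENNReal.ofReal p) P ≤
      ENNReal.ofReal (Real.sqrt p * (τ * ‖θ‖)) := by
  rcases eq_or_ne θ 0 with rfl | hθ
  · simp
  have hn : ‖θ‖ ≠ 0 := norm_ne_zero_iff.2 hθ
  have h1 := (h (‖θ‖⁻¹ • θ) (by rw [norm_smul, norm_inv, norm_norm, inv_mul_cancel₀ hn])).eLpNorm_le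
    hp
  have h2 : (fun ω => inner ℝ θ (z ω)) = ‖θ‖ • fun ω => inner ℝ (‖θ‖⁻¹ • θ) (z ω) := by
    funext ω
    rw [Pi.smul_apply, real_inner_smul_left, smul_eq_mul, ← mul_assoc, mul_inv_cancel₀ hn, one_mul]
  rw [h2, eLpNorm_const_smul, enorm_norm, ← ofReal_norm]
  calc ENNReal.ofReal ‖θ‖ * _ ≤ ENNReal.ofReal ‖θ‖ * ENNReal.ofReal (Real.sqrt p * τ) := by gcongr
    _ = _ := by rw [← ENNReal.ofReal_mul (norm_nonneg _)]; congr 1; ring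

section

variable {ι : Type*} [Fintype ι] {D : Measure (EuclideanSpace ℝ ι × ℝ)}
  {σ τ : ℝ}

theorem measurable_inner_fst (θ : EuclideanSpace ℝ ι) :
    Measurable fun z : EuclideanSpace ℝ ι × ℝ => (inner ℝ θ z.1 : ℝ) :=
  measurable_const.inner measurable_fst

theorem eLpNorm_mul_inner_le (hτ : 0 ≤ τ) (hx : IsSubGVec D (fun z => z.1) τ)
    (hy : IsSubG D (fun z => z.2) σ) (θ : EuclideanSpace ℝ ι) {k : ℕ} (hk : 1 ≤ k) :
    eLpNorm (fun z => z.2 * inner ℝ θ z.1) k D ≤ ENNReal.ofReal (2 * k * (σ * τ * ‖θ‖)) := by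
  have hk' : (1 : ℝ) ≤ k := by exact_mod_cast hk
  have hp : (1 : ℝ) ≤ 2 * k := by linarith
  -- The exponents `2k`, `2k`, `k` form a Hölder triple.
  have : ENNReal.HolderTriple (ENNReal.ofReal (2 * k)) (ENNReal.ofReal (2 * k)) (k : ℝ≥0∞) := by
    constructor
    rw [← ENNReal.ofReal_inv_of_pos (by linarith), ← ENNReal.ofReal_add (by positivity)
      (by positivity), ← ENNReal.ofReal_natCast, ← ENNReal.ofReal_inv_of_pos (by linarith)]
    congr 1
    field_simp
    norm_num
  have h1 := eLpNorm_smul_le_mul_eLpNorm (p := ENNReal.ofReal (2 * k))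
    (q := ENNReal.ofReal (2 * k)) (r := (k : ℝ≥0∞)) (μ := D)
    (measurable_inner_fst θ).aestronglyMeasurable
    (φ := fun z : EuclideanSpace ℝ ι × ℝ => z.2) measurable_snd.aestronglyMeasurable
  refine h1.trans ?_
  calc _ ≤ ENNReal.ofReal (Real.sqrt (2 * k) * σ) *
          ENNReal.ofReal (Real.sqrt (2 * k) * (τ * ‖θ‖)) :=
        mul_le_mul' (hy.eLpNorm_le hp) (hx.eLpNorm_inner_le θ hp)
    _ = _ := by
        rw [← ENNReal.ofReal_mul' (by positivity)]
        congr 1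
        have := Real.mul_self_sqrt (show (0 : ℝ) ≤ 2 * k by linarith)
        linear_combination (σ * τ * ‖θ‖) * this

theorem integrable_mul_inner (hτ : 0 ≤ τ) (hx : IsSubGVec D (fun z => z.1) τ)
    (hy : IsSubG D (fun z => z.2) σ) (θ : EuclideanSpace ℝ ι) :
    Integrable (fun z => z.2 * inner ℝ θ z.1) D := by
  rw [← memLp_one_iff_integrable]
  refine ⟨(measurable_snd.mul (measurable_inner_fst θ)).aestronglyMeasurable, ?_⟩
  have := eLpNorm_mul_inner_le hτ hx hy θ le_rfl
  rw [Nat.cast_one] at this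
  exact this.trans_lt ENNReal.ofReal_lt_top

theorem integrable_smul (hτ : 0 ≤ τ) (hx : IsSubGVec D (fun z => z.1) τ)
    (hy : IsSubG D (fun z => z.2) σ) : Integrable (fun z => z.2 • z.1) D := by
  classical
  rw [← memLp_one_iff_integrable, memLp_piLp_iff]
  intro i
  rw [memLp_one_iff_integrable]
  refine (integrable_mul_inner hτ hx hy (EuclideanSpace.single i 1)).congr (ae_of_all _ fun z => ?_)
  simp [EuclideanSpace.inner_single_left]

/-- The centred product `y x - E[y x]` has sub-exponential moments in every direction. -/
theorem centeredSubExpVec_smul [IsProbabilityMeasure D] (hσ : 0 ≤ σ) (hτ : 0 ≤ τ)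
    (hx : IsSubGVec D (fun z => z.1) τ) (hy : IsSubG D (fun z => z.2) σ) :
    CenteredSubExpVec D (fun z => z.2 • z.1 - ∫ z, z.2 • z.1 ∂D) (4 * (σ * τ)) := by
  set b := ∫ z, z.2 • z.1 ∂D with hb
  have hi := integrable_smul hτ hx hy
  have hm : Measurable fun z : EuclideanSpace ℝ ι × ℝ => z.2 • z.1 - b :=
    (measurable_snd.smul measurable_fst).sub_const b
  have hmean (θ : EuclideanSpace ℝ ι) : ∫ z, z.2 * inner ℝ θ z.1 ∂D = inner ℝ θ b := by
    rw [hb, ← integral_inner hi]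
    simp only [real_inner_smul_right]
  have hrw (θ : EuclideanSpace ℝ ι) :
      (fun z : EuclideanSpace ℝ ι × ℝ => inner ℝ θ (z.2 • z.1 - b)) =
      (fun z => z.2 * inner ℝ θ z.1) - fun _ => inner ℝ θ b := by
    funext z
    simp only [inner_sub_right, real_inner_smul_right, Pi.sub_apply]
  refine ⟨hm, by positivity, fun θ => ?_, fun θ => ?_⟩
  · rw [hrw]
    rw [integral_sub' (integrable_mul_inner hτ hx hy θ) (integrable_const _), hmean]
    simp
  · refine SubExpMoments.of_eLpNorm_le (measurable_const.inner hm) (by positivity) fun k hk => ?_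
    rw [hrw]
    have hmeas : AEStronglyMeasurable (fun z : EuclideanSpace ℝ ι × ℝ => z.2 * inner ℝ θ z.1) D :=
      (measurable_snd.mul (measurable_inner_fst θ)).aestronglyMeasurable
    have hk' : (1 : ℝ≥0∞) ≤ k := by exact_mod_cast hk
    have h1 := eLpNorm_mul_inner_le hτ hx hy θ hk
    have h2 : eLpNorm (fun _ : EuclideanSpace ℝ ι × ℝ => (inner ℝ θ b : ℝ)) k D ≤
        ENNReal.ofReal (2 * k * (σ * τ * ‖θ‖)) := by
      rw [eLpNorm_const _ (by simpa using (by omega : k ≠ 0)) (NeZero.ne D)]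
      simp only [measure_univ, ENNReal.one_rpow, mul_one]
      rw [← hmean]
      refine (enorm_integral_le_lintegral_enorm _).trans ?_
      rw [← eLpNorm_one_eq_lintegral_enorm]
      exact (eLpNorm_le_eLpNorm_of_exponent_le hk' hmeas).trans h1
    refine (eLpNorm_sub_le hmeas aestronglyMeasurable_const hk').trans ((add_le_add h1 h2).trans ?_)
    rw [← ENNReal.ofReal_add (by positivity) (by positivity)]
    exact le_of_eq (by congr 1; ring)

end

/-! ### Quadratic forms and spectral perturbation -/

section

variable {ι : Type*} [Fintype ι] [DecidableEq ι]

theorem toEuclideanLin_mul (M N : Matrix ι ι ℝ) (v : EuclideanSpace ℝ ι) :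
    Matrix.toEuclideanLin (M * N) v = Matrix.toEuclideanLin M (Matrix.toEuclideanLin N v) := by
  simp only [Matrix.toLpLin_apply, Matrix.mulVec_mulVec]

theorem toEuclideanLin_one (v : EuclideanSpace ℝ ι) :
    Matrix.toEuclideanLin (1 : Matrix ι ι ℝ) v = v := by
  simp only [Matrix.toLpLin_apply, Matrix.one_mulVec]

theorem inner_toEuclideanLin_eq (M : Matrix ι ι ℝ) (u v : EuclideanSpace ℝ ι) :
    inner ℝ u (Matrix.toEuclideanLin M v) = u.ofLp ⬝ᵥ M.mulVec v.ofLp := by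
  rw [Matrix.toLpLin_apply, EuclideanSpace.inner_eq_star_dotProduct, dotProduct_comm]
  simp

theorem Matrix.IsHermitian.inner_toEuclideanLin {M : Matrix ι ι ℝ} (hM : M.IsHermitian)
    (u v : EuclideanSpace ℝ ι) :
    inner ℝ u (Matrix.toEuclideanLin M v) = inner ℝ (Matrix.toEuclideanLin M u) v := by
  have hT : M.transpose = M := by
    rw [← Matrix.conjTranspose_eq_transpose_of_trivial]; exact hM
  rw [inner_toEuclideanLin_eq, real_inner_comm, inner_toEuclideanLin_eq, Matrix.dotProduct_mulVec,
    ← Matrix.mulVec_transpose, hT, dotProduct_comm]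

theorem Matrix.PosSemidef.inner_nonneg {M : Matrix ι ι ℝ} (hM : M.PosSemidef)
    (v : EuclideanSpace ℝ ι) : 0 ≤ inner ℝ v (Matrix.toEuclideanLin M v) := by
  rw [inner_toEuclideanLin_eq]
  simpa using hM.dotProduct_mulVec_nonneg v.ofLp

theorem Matrix.IsHermitian.le_inner_of_le_spectrum {M : Matrix ι ι ℝ} (hM : M.IsHermitian) {r : ℝ}
    (hr : ∀ t ∈ spectrum ℝ M, r ≤ t) (v : EuclideanSpace ℝ ι) :
    r * ‖v‖ ^ 2 ≤ inner ℝ v (Matrix.toEuclideanLin M v) := by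
  have hs : IsSelfAdjoint M := hM
  have h := (algebraMap_le_iff_le_spectrum (a := M)).2 hr
  have h2 := (Matrix.le_iff.1 h).inner_nonneg v
  rw [Algebra.algebraMap_eq_smul_one, map_sub, map_smul, LinearMap.sub_apply, LinearMap.smul_apply,
    toEuclideanLin_one, inner_sub_right, inner_smul_right, real_inner_self_eq_norm_sq] at h2
  linarith

theorem Matrix.IsHermitian.inner_le_of_spectrum_le {M : Matrix ι ι ℝ} (hM : M.IsHermitian) {r : ℝ}
    (hr : ∀ t ∈ spectrum ℝ M, t ≤ r) (v : EuclideanSpace ℝ ι) :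
    inner ℝ v (Matrix.toEuclideanLin M v) ≤ r * ‖v‖ ^ 2 := by
  have hs : IsSelfAdjoint M := hM
  have h := (le_algebraMap_iff_spectrum_le (a := M)).2 hr
  have h2 := (Matrix.le_iff.1 h).inner_nonneg v
  rw [Algebra.algebraMap_eq_smul_one, map_sub, map_smul, LinearMap.sub_apply, LinearMap.smul_apply,
    toEuclideanLin_one, inner_sub_right, inner_smul_right, real_inner_self_eq_norm_sq] at h2
  linarith

/-- The seminorm `‖M^{1/2} v‖` attached to a positive semidefinite matrix `M`. -/
noncomputable def matNorm (M : Matrix ι ι ℝ) (v : EuclideanSpace ℝ ι) : ℝ :=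
  ‖Matrix.toEuclideanLin (CFC.sqrt M) v‖

theorem matNorm_nonneg (M : Matrix ι ι ℝ) (v : EuclideanSpace ℝ ι) : 0 ≤ matNorm M v :=
  norm_nonneg _

theorem matNorm_sub_le (M : Matrix ι ι ℝ) (u v : EuclideanSpace ℝ ι) :
    matNorm M (u - v) ≤ matNorm M u + matNorm M v := by
  rw [matNorm, map_sub]; exact norm_sub_le _ _

theorem abs_matNorm_sub_le (M : Matrix ι ι ℝ) (u v : EuclideanSpace ℝ ι) :
    |matNorm M u - matNorm M v| ≤ matNorm M (u - v) := by
  rw [matNorm, matNorm, matNorm, map_sub]; exact abs_norm_sub_norm_le _ _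

theorem isHermitian_sqrt (M : Matrix ι ι ℝ) : (CFC.sqrt M).IsHermitian :=
  (Matrix.nonneg_iff_posSemidef.1 (CFC.sqrt_nonneg M)).1

theorem Matrix.PosSemidef.inner_eq_sqrt {M : Matrix ι ι ℝ} (hM : M.PosSemidef)
    (u v : EuclideanSpace ℝ ι) : inner ℝ u (Matrix.toEuclideanLin M v) =
      inner ℝ (Matrix.toEuclideanLin (CFC.sqrt M) u) (Matrix.toEuclideanLin (CFC.sqrt M) v) := by
  conv_lhs => rw [← CFC.sqrt_mul_sqrt_self M (Matrix.nonneg_iff_posSemidef.2 hM)]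
  rw [toEuclideanLin_mul, (isHermitian_sqrt M).inner_toEuclideanLin]

theorem Matrix.PosSemidef.matNorm_sq {M : Matrix ι ι ℝ} (hM : M.PosSemidef)
    (v : EuclideanSpace ℝ ι) : matNorm M v ^ 2 = inner ℝ v (Matrix.toEuclideanLin M v) := by
  rw [hM.inner_eq_sqrt, real_inner_self_eq_norm_sq, matNorm]

theorem Matrix.PosSemidef.abs_inner_le {M : Matrix ι ι ℝ} (hM : M.PosSemidef)
    (u v : EuclideanSpace ℝ ι) :
    |inner ℝ u (Matrix.toEuclideanLin M v)| ≤ matNorm M u * matNorm M v := by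
  rw [hM.inner_eq_sqrt]; exact abs_real_inner_le_norm _ _

/-- The two-sided Loewner comparison `(1 - ε)² Σ ≤ S ≤ (1 + ε)² Σ` on quadratic forms. -/
def LoewnerClose (Sig S : Matrix ι ι ℝ) (ε : ℝ) : Prop :=
  ∀ v : EuclideanSpace ℝ ι,
    (1 - ε) ^ 2 * matNorm Sig v ^ 2 ≤ inner ℝ v (Matrix.toEuclideanLin S v) ∧
      inner ℝ v (Matrix.toEuclideanLin S v) ≤ (1 + ε) ^ 2 * matNorm Sig v ^ 2

theorem SpectrallyClose.loewnerClose {Sig S : Matrix ι ι ℝ} {ε : ℝ} (hSig : Sig.PosDef)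
    (hS : S.IsHermitian) (h : SpectrallyClose Sig S ε) (hε : ε ≤ 1 / 2) : LoewnerClose Sig S ε := by
  intro v
  set W := CFC.sqrt Sig with hW
  have hWh : W.IsHermitian := isHermitian_sqrt Sig
  have hWu : IsUnit W :=
    (CFC.isUnit_sqrt_iff Sig (Matrix.nonneg_iff_posSemidef.2 hSig.posSemidef)).2 hSig.isUnit
  have hWd : IsUnit W.det := (Matrix.isUnit_iff_isUnit_det W).1 hWu
  have hM : (W⁻¹ * S * W⁻¹).IsHermitian := by
    have := Matrix.isHermitian_mul_mul_conjTranspose W⁻¹ hS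
    rwa [hWh.inv.eq] at this
  have hwv : Matrix.toEuclideanLin W⁻¹ (Matrix.toEuclideanLin W v) = v := by
    rw [← toEuclideanLin_mul, Matrix.nonsing_inv_mul _ hWd, toEuclideanLin_one]
  have hform : inner ℝ (Matrix.toEuclideanLin W v)
      (Matrix.toEuclideanLin (W⁻¹ * S * W⁻¹) (Matrix.toEuclideanLin W v)) =
      inner ℝ v (Matrix.toEuclideanLin S v) := by
    rw [toEuclideanLin_mul, toEuclideanLin_mul, hwv, hWh.inv.inner_toEuclideanLin, hwv]
  have ht (t : ℝ) (hts : t ∈ spectrum ℝ (W⁻¹ * S * W⁻¹)) :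
      (1 - ε) ^ 2 ≤ t ∧ t ≤ (1 + ε) ^ 2 := by
    obtain ⟨h1, h2⟩ := h t hts
    have hpos : 0 < t := Real.sqrt_pos.1 (by linarith)
    rw [← Real.sq_sqrt hpos.le]
    exact ⟨pow_le_pow_left₀ (by linarith) h1 2, pow_le_pow_left₀ (Real.sqrt_nonneg _) h2 2⟩
  rw [← hform]
  exact ⟨hM.le_inner_of_le_spectrum (fun t h => (ht t h).1) _,
    hM.inner_le_of_spectrum_le (fun t h => (ht t h).2) _⟩

/-- The spectrum of a real symmetric matrix of positive size is nonempty, which forces the interval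
`[1 - ε, 1 + ε]` to be nonempty. -/
theorem SpectrallyClose.eps_nonneg [Nonempty ι] {Sig S : Matrix ι ι ℝ} {ε : ℝ}
    (hS : S.IsHermitian) (h : SpectrallyClose Sig S ε) : 0 ≤ ε := by
  have hM : ((CFC.sqrt Sig)⁻¹ * S * (CFC.sqrt Sig)⁻¹).IsHermitian := by
    have := Matrix.isHermitian_mul_mul_conjTranspose (CFC.sqrt Sig)⁻¹ hS
    rwa [(isHermitian_sqrt Sig).inv.eq] at this
  have hs : IsSelfAdjoint ((CFC.sqrt Sig)⁻¹ * S * (CFC.sqrt Sig)⁻¹) := hM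
  obtain ⟨t, ht⟩ := ContinuousFunctionalCalculus.spectrum_nonempty (R := ℝ) _ hs
  obtain ⟨h1, h2⟩ := h t ht
  linarith

theorem lamMin_pos [Nonempty ι] {M : Matrix ι ι ℝ} (hM : M.PosDef) : 0 < lamMin M := by
  have hs : IsSelfAdjoint M := hM.1
  have hne := ContinuousFunctionalCalculus.spectrum_nonempty (R := ℝ) M hs
  have hmem := hne.csInf_mem (Matrix.finite_real_spectrum (A := M))
  rw [hM.1.spectrum_real_eq_range_eigenvalues] at hmem
  obtain ⟨i, hi⟩ := hmem
  rw [lamMin, hM.1.spectrum_real_eq_range_eigenvalues, ← hi]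
  exact hM.eigenvalues_pos i

theorem lamMin_le_lamMax [Nonempty ι] {M : Matrix ι ι ℝ} (hM : M.IsHermitian) :
    lamMin M ≤ lamMax M := by
  have hs : IsSelfAdjoint M := hM
  have hf := Matrix.finite_real_spectrum (A := M)
  exact Real.sInf_le_sSup _ hf.bddBelow hf.bddAbove

theorem lamMin_mul_norm_sq_le {M : Matrix ι ι ℝ} (hM : M.PosSemidef) (v : EuclideanSpace ℝ ι) :
    lamMin M * ‖v‖ ^ 2 ≤ matNorm M v ^ 2 := by
  rw [hM.matNorm_sq]
  exact hM.1.le_inner_of_le_spectrum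
    (fun t ht => csInf_le (Matrix.finite_real_spectrum (A := M)).bddBelow ht) v

theorem LoewnerClose.posDef {Sig S : Matrix ι ι ℝ} {ε lam : ℝ} (h : LoewnerClose Sig S ε)
    (hS : S.IsHermitian) (hε : ε ≤ 1 / 2) (hlam : 0 < lam)
    (hform : ∀ v : EuclideanSpace ℝ ι, lam * ‖v‖ ^ 2 ≤ matNorm Sig v ^ 2) : S.PosDef := by
  refine Matrix.PosDef.of_dotProduct_mulVec_pos hS fun x hx => ?_
  have h1 := (h (WithLp.toLp 2 x)).1
  rw [inner_toEuclideanLin_eq] at h1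
  have h2 := hform (WithLp.toLp 2 x)
  have h3 : 0 < ‖(WithLp.toLp 2 x : EuclideanSpace ℝ ι)‖ := by
    rw [norm_pos_iff]
    simpa using hx
  have h4 : 0 < 1 - ε := by linarith
  have h5 : 0 < matNorm Sig (WithLp.toLp 2 x) ^ 2 := lt_of_lt_of_le (by positivity) h2
  exact lt_of_lt_of_le (by positivity) h1

theorem LoewnerClose.matNorm_le {Sig S : Matrix ι ι ℝ} {ε : ℝ} (h : LoewnerClose Sig S ε)
    (hS : S.PosSemidef) (hε0 : 0 ≤ ε) (v : EuclideanSpace ℝ ι) :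
    (1 - ε) * matNorm Sig v ≤ matNorm S v ∧ matNorm S v ≤ (1 + ε) * matNorm Sig v := by
  obtain ⟨h1, h2⟩ := h v
  rw [← hS.matNorm_sq, ← mul_pow] at h1 h2
  exact ⟨le_of_sq_le_sq h1 (matNorm_nonneg _ _),
    le_of_sq_le_sq h2 (mul_nonneg (by linarith) (matNorm_nonneg _ _))⟩

/-- Stability of the solution of a positive definite linear system under a spectrally small
perturbation of the matrix, in the norm attached to that matrix. -/
theorem LoewnerClose.solution_bounds {Sig S : Matrix ι ι ℝ} {ε lam : ℝ} (h : LoewnerClose Sig S ε)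
    (hSig : Sig.PosDef) (hS : S.IsHermitian) (hε0 : 0 ≤ ε) (hε : ε ≤ 1 / 2) (hlam : 0 < lam)
    (hform : ∀ v : EuclideanSpace ℝ ι, lam * ‖v‖ ^ 2 ≤ matNorm Sig v ^ 2)
    {b β γ : EuclideanSpace ℝ ι} (hβ : Matrix.toEuclideanLin Sig β = b)
    (hγ : Matrix.toEuclideanLin S γ = b) :
    matNorm Sig γ ≤ 4 * (‖b‖ / Real.sqrt lam) ∧
      matNorm Sig (γ - β) ≤ 24 * ε * (‖b‖ / Real.sqrt lam) := by
  have hsl : 0 < Real.sqrt lam := Real.sqrt_pos.2 hlam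
  have hP := hSig.posSemidef
  have nn (v : EuclideanSpace ℝ ι) := matNorm_nonneg Sig v
  -- `‖β‖_Σ² = ⟨β, b⟩` and `√λ ‖β‖ ≤ ‖β‖_Σ`.
  have hβb : matNorm Sig β ≤ ‖b‖ / Real.sqrt lam := by
    have h1 : matNorm Sig β ^ 2 ≤ ‖β‖ * ‖b‖ := by
      rw [hP.matNorm_sq, hβ]; exact real_inner_le_norm _ _
    have h2 : Real.sqrt lam * ‖β‖ ≤ matNorm Sig β := by
      refine le_of_sq_le_sq ?_ (nn β)
      rw [mul_pow, Real.sq_sqrt hlam.le]; exact hform β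
    rw [le_div_iff₀ hsl]
    rcases (nn β).eq_or_lt with h0 | h0
    · rw [← h0, zero_mul]; exact norm_nonneg _
    · refine le_of_mul_le_mul_left ?_ h0
      nlinarith [mul_le_mul_of_nonneg_left h1 hsl.le,
        mul_le_mul_of_nonneg_right h2 (norm_nonneg b)]
  have hγβ : matNorm Sig γ ≤ 4 * matNorm Sig β := by
    have h1 := (h γ).1
    have h2 : inner ℝ γ (Matrix.toEuclideanLin S γ) ≤ matNorm Sig γ * matNorm Sig β := by
      rw [hγ, ← hβ]; exact (le_abs_self _).trans (hP.abs_inner_le γ β)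
    rcases (nn γ).eq_or_lt with h0 | h0
    · rw [← h0]; have := nn β; positivity
    · refine le_of_mul_le_mul_left ?_ h0
      have h3 : 1 / 4 ≤ (1 - ε) ^ 2 := by nlinarith
      nlinarith [mul_le_mul_of_nonneg_right h3 (sq_nonneg (matNorm Sig γ))]
  have hdiff : matNorm Sig (γ - β) ≤ 6 * ε * matNorm Sig γ := by
    -- `‖γ - β‖_Σ² = ⟨γ - β, (Σ - S) γ⟩`. Writing `S = (1 - ε)² Σ + T` with `0 ≤ T ≤ 4 ε Σ` lets
    -- Cauchy–Schwarz be used for the two positive semidefinite forms `Σ` and `T`.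
    set T := S - (1 - ε) ^ 2 • Sig with hT
    have happ (v : EuclideanSpace ℝ ι) : Matrix.toEuclideanLin T v =
        Matrix.toEuclideanLin S v - (1 - ε) ^ 2 • Matrix.toEuclideanLin Sig v := by
      rw [hT, map_sub, map_smul, LinearMap.sub_apply, LinearMap.smul_apply]
    have hTv (v : EuclideanSpace ℝ ι) : inner ℝ v (Matrix.toEuclideanLin T v) =
        inner ℝ v (Matrix.toEuclideanLin S v) - (1 - ε) ^ 2 * matNorm Sig v ^ 2 := by
      rw [happ, inner_sub_right, inner_smul_right, hP.matNorm_sq]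
    have hTP : T.PosSemidef := by
      have hTh : T.IsHermitian := hS.sub (by
        rw [Matrix.IsHermitian, Matrix.conjTranspose_smul, hSig.1.eq, star_trivial])
      refine Matrix.PosSemidef.of_dotProduct_mulVec_nonneg hTh fun x => ?_
      have := hTv (WithLp.toLp 2 x)
      rw [inner_toEuclideanLin_eq] at this
      rw [star_trivial, this]
      linarith [(h (WithLp.toLp 2 x)).1]
    have hTn (v : EuclideanSpace ℝ ι) : matNorm T v ≤ 2 * Real.sqrt ε * matNorm Sig v := by
      refine le_of_sq_le_sq ?_ (by have := nn v; positivity)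
      rw [hTP.matNorm_sq, hTv, mul_pow, mul_pow, Real.sq_sqrt hε0]
      nlinarith [(h v).2]
    have hsplit : matNorm Sig (γ - β) ^ 2 =
        (1 - (1 - ε) ^ 2) * inner ℝ (γ - β) (Matrix.toEuclideanLin Sig γ) -
          inner ℝ (γ - β) (Matrix.toEuclideanLin T γ) := by
      rw [hP.matNorm_sq, happ, map_sub, hβ, hγ, inner_sub_right, inner_sub_right, inner_smul_right]
      ring
    have b1 := (le_abs_self _).trans (hP.abs_inner_le (γ - β) γ)
    have b2 := (neg_le_abs _).trans (hTP.abs_inner_le (γ - β) γ)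
    have b3 : matNorm T (γ - β) * matNorm T γ ≤
        4 * ε * (matNorm Sig (γ - β) * matNorm Sig γ) := by
      calc _ ≤ (2 * Real.sqrt ε * matNorm Sig (γ - β)) * (2 * Real.sqrt ε * matNorm Sig γ) :=
            mul_le_mul (hTn _) (hTn _) (matNorm_nonneg _ _)
              (by have := nn (γ - β); positivity)
        _ = _ := by
            linear_combination
              (4 * matNorm Sig (γ - β) * matNorm Sig γ) * Real.mul_self_sqrt hε0
    rcases (nn (γ - β)).eq_or_lt with h0 | h0
    · rw [← h0]; have := nn γ; positivity
    · refine le_of_mul_le_mul_left ?_ h0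
      have h5 : 0 ≤ 1 - (1 - ε) ^ 2 := by nlinarith
      have h6 : 1 - (1 - ε) ^ 2 ≤ 2 * ε := by nlinarith
      have h7 := mul_nonneg (nn (γ - β)) (nn γ)
      nlinarith [mul_le_mul_of_nonneg_left b1 h5, mul_le_mul_of_nonneg_right h6 h7]
  refine ⟨hγβ.trans (by gcongr), hdiff.trans ?_⟩
  calc 6 * ε * matNorm Sig γ ≤ 6 * ε * (4 * (‖b‖ / Real.sqrt lam)) := by
        gcongr; exact hγβ.trans (by gcongr)
    _ = _ := by ring

end

/-! ### Block structure and normal equations -/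

/-- The isometric embedding `v ↦ (v, 0)` into the first block. -/
def extendZero {ι κ : Type*} (v : EuclideanSpace ℝ ι) : EuclideanSpace ℝ (ι ⊕ κ) :=
  WithLp.toLp 2 (Sum.elim v.ofLp 0)

theorem extendZero_sub {ι κ : Type*} (u v : EuclideanSpace ℝ ι) :
    extendZero (κ := κ) (u - v) = extendZero u - extendZero v := by
  ext i
  cases i <;> simp [extendZero]

theorem Matrix.PosDef.toBlocks₁₁_posDef {ι κ : Type*} {M : Matrix (ι ⊕ κ) (ι ⊕ κ) ℝ}
    (hM : M.PosDef) :
    M.toBlocks₁₁.PosDef :=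
  hM.submatrix (e := Sum.inl) Sum.inl_injective

theorem pinv_eq_inv {ι : Type*} [Fintype ι] [DecidableEq ι] {M : Matrix ι ι ℝ} (hM : M.PosDef) :
    pinv M = M⁻¹ := by
  have hd : IsUnit M.det := (Matrix.isUnit_iff_isUnit_det M).1 hM.isUnit
  refine pinv_eq_of_isPseudoinverse ⟨?_, ?_, ?_, ?_⟩ <;>
  simp [Matrix.mul_nonsing_inv _ hd, Matrix.nonsing_inv_mul _ hd]

theorem toEuclideanLin_inv_left {ι : Type*} [Fintype ι] [DecidableEq ι] {M : Matrix ι ι ℝ}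
    (hM : M.PosDef) (v : EuclideanSpace ℝ ι) :
    Matrix.toEuclideanLin M (Matrix.toEuclideanLin M⁻¹ v) = v := by
  rw [← toEuclideanLin_mul, Matrix.mul_nonsing_inv _ ((Matrix.isUnit_iff_isUnit_det M).1 hM.isUnit),
    toEuclideanLin_one]

section

variable {ι κ : Type*} [Fintype ι] [Fintype κ]

theorem inner_extendZero (v : EuclideanSpace ℝ ι) (x : EuclideanSpace ℝ (ι ⊕ κ)) :
    inner ℝ (extendZero v) x = inner ℝ v (firstBlock x) := by
  simp [extendZero, firstBlock, PiLp.inner_apply, Fintype.sum_sum_type]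

theorem norm_extendZero (v : EuclideanSpace ℝ ι) : ‖extendZero (κ := κ) v‖ = ‖v‖ := by
  have h : firstBlock (extendZero (κ := κ) v) = v := by
    ext i; simp [extendZero, firstBlock]
  have : ‖extendZero (κ := κ) v‖ ^ 2 = ‖v‖ ^ 2 := by
    rw [← real_inner_self_eq_norm_sq, inner_extendZero, h, real_inner_self_eq_norm_sq]
  exact (sq_eq_sq₀ (norm_nonneg _) (norm_nonneg _)).1 this

theorem norm_firstBlock_le (x : EuclideanSpace ℝ (ι ⊕ κ)) : ‖firstBlock x‖ ≤ ‖x‖ := by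
  refine le_of_sq_le_sq ?_ (norm_nonneg x)
  rw [EuclideanSpace.real_norm_sq_eq, EuclideanSpace.real_norm_sq_eq, Fintype.sum_sum_type]
  have : 0 ≤ ∑ i : κ, x.ofLp (Sum.inr i) ^ 2 := Finset.sum_nonneg fun _ _ => sq_nonneg _
  simpa [firstBlock] using this

variable [DecidableEq ι] [DecidableEq κ]

theorem inner_extendZero_toEuclideanLin (M : Matrix (ι ⊕ κ) (ι ⊕ κ) ℝ)
    (u v : EuclideanSpace ℝ ι) :
    inner ℝ (extendZero u) (Matrix.toEuclideanLin M (extendZero v)) =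
      inner ℝ u (Matrix.toEuclideanLin M.toBlocks₁₁ v) := by
  rw [inner_extendZero, inner_toEuclideanLin_eq]
  simp [firstBlock, extendZero, PiLp.inner_apply, Matrix.mulVec, dotProduct, Matrix.toBlocks₁₁,
    mul_comm]

theorem matNorm_extendZero {M : Matrix (ι ⊕ κ) (ι ⊕ κ) ℝ} (hM : M.PosDef)
    (v : EuclideanSpace ℝ ι) : matNorm M (extendZero v) = matNorm M.toBlocks₁₁ v := by
  refine (sq_eq_sq₀ (matNorm_nonneg _ _) (matNorm_nonneg _ _)).1 ?_
  rw [hM.posSemidef.matNorm_sq, hM.toBlocks₁₁_posDef.posSemidef.matNorm_sq,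
    inner_extendZero_toEuclideanLin]

theorem pinv_fromBlocks {M : Matrix ι ι ℝ} (hM : M.PosDef) :
    pinv (Matrix.fromBlocks M 0 0 (0 : Matrix κ κ ℝ)) = Matrix.fromBlocks M⁻¹ 0 0 0 := by
  have hd : IsUnit M.det := (Matrix.isUnit_iff_isUnit_det M).1 hM.isUnit
  refine pinv_eq_of_isPseudoinverse ⟨?_, ?_, ?_, ?_⟩ <;>
  simp [Matrix.fromBlocks_multiply, Matrix.fromBlocks_transpose, Matrix.mul_nonsing_inv _ hd,
    Matrix.nonsing_inv_mul _ hd]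

theorem toEuclideanLin_residualMatrix {S : Matrix (ι ⊕ κ) (ι ⊕ κ) ℝ} {S₁ : Matrix ι ι ℝ}
    (hS : S.PosDef) (hS₁ : S₁.PosDef) (v : EuclideanSpace ℝ (ι ⊕ κ)) :
    Matrix.toEuclideanLin (residualMatrix S S₁) v =
      extendZero (Matrix.toEuclideanLin S₁⁻¹ (firstBlock v)) - Matrix.toEuclideanLin S⁻¹ v := by
  rw [residualMatrix, pinv_eq_inv hS, pinv_fromBlocks hS₁, map_sub, LinearMap.sub_apply]
  congr 1
  simp only [Matrix.toLpLin_apply, Matrix.fromBlocks_mulVec, extendZero, firstBlock]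
  congr 1
  simp
  rfl

/-- Size of `R̂ v` in the norm of the true second moment matrix, and its distance to the population
residual `(β₁, 0) - β`. -/
theorem residual_bounds {Sig S : Matrix (ι ⊕ κ) (ι ⊕ κ) ℝ} {S₁ : Matrix ι ι ℝ} {ε lam : ℝ}
    (hSig : Sig.PosDef) (hS : S.IsHermitian) (hS₁ : S₁.IsHermitian) (h : LoewnerClose Sig S ε)
    (h₁ : LoewnerClose Sig.toBlocks₁₁ S₁ ε) (hε0 : 0 ≤ ε) (hε : ε ≤ 1 / 2) (hlam : 0 < lam)
    (hform : ∀ v : EuclideanSpace ℝ (ι ⊕ κ), lam * ‖v‖ ^ 2 ≤ matNorm Sig v ^ 2)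
    (b β : EuclideanSpace ℝ (ι ⊕ κ)) (β₁ : EuclideanSpace ℝ ι)
    (hβ : Matrix.toEuclideanLin Sig β = b)
    (hβ₁ : Matrix.toEuclideanLin Sig.toBlocks₁₁ β₁ = firstBlock b) :
    matNorm Sig (Matrix.toEuclideanLin (residualMatrix S S₁) b) ≤ 8 * (‖b‖ / Real.sqrt lam) ∧
      matNorm Sig (Matrix.toEuclideanLin (residualMatrix S S₁) b - (extendZero β₁ - β)) ≤
        48 * ε * (‖b‖ / Real.sqrt lam) := by
  have hform₁ (v : EuclideanSpace ℝ ι) :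
      lam * ‖v‖ ^ 2 ≤ matNorm Sig.toBlocks₁₁ v ^ 2 := by
    rw [← matNorm_extendZero hSig, ← norm_extendZero (κ := κ)]; exact hform _
  have hSp := h.posDef hS hε hlam hform
  have hSp₁ := h₁.posDef hS₁ hε hlam hform₁
  obtain ⟨a1, a2⟩ := h.solution_bounds hSig hS hε0 hε hlam hform hβ (toEuclideanLin_inv_left hSp b)
  obtain ⟨c1, c2⟩ := h₁.solution_bounds hSig.toBlocks₁₁_posDef hS₁ hε0 hε hlam hform₁ hβ₁
    (toEuclideanLin_inv_left hSp₁ (firstBlock b))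
  have hle : ‖firstBlock b‖ / Real.sqrt lam ≤ ‖b‖ / Real.sqrt lam := by
    gcongr; exact norm_firstBlock_le b
  rw [toEuclideanLin_residualMatrix hSp hSp₁]
  constructor
  · refine (matNorm_sub_le _ _ _).trans ?_
    rw [matNorm_extendZero hSig]
    linarith
  · rw [sub_sub_sub_comm, ← extendZero_sub]
    refine (matNorm_sub_le _ _ _).trans ?_
    rw [matNorm_extendZero hSig]
    have := mul_le_mul_of_nonneg_left hle (show (0 : ℝ) ≤ 24 * ε by positivity)
    linarith

end

section

variable {Ω : Type*} [MeasurableSpace Ω] {P : Measure Ω}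

/-- Orthogonality of the residual at a minimizer of the square loss along a line. -/
theorem integral_mul_eq_zero_of_minimal {g k : Ω → ℝ} (hg : MemLp g 2 P) (hk : MemLp k 2 P)
    (hmin : ∀ t : ℝ, ∫ ω, g ω ^ 2 ∂P ≤ ∫ ω, (g ω + t * k ω) ^ 2 ∂P) : ∫ ω, g ω * k ω ∂P = 0 := by
  have ig := hg.integrable_sq
  have ik := hk.integrable_sq
  have igk : Integrable (fun ω => g ω * k ω) P := hg.integrable_mul hk
  have hexp (t : ℝ) : ∫ ω, (g ω + t * k ω) ^ 2 ∂P =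
      ∫ ω, g ω ^ 2 ∂P + (2 * t * ∫ ω, g ω * k ω ∂P + t ^ 2 * ∫ ω, k ω ^ 2 ∂P) := by
    have i1 : Integrable (fun ω => 2 * t * (g ω * k ω)) P := igk.const_mul _
    have i2 : Integrable (fun ω => t ^ 2 * k ω ^ 2) P := ik.const_mul _
    rw [← integral_const_mul, ← integral_const_mul, ← integral_add i1 i2]
    refine Eq.trans ?_ (integral_add ig (i1.add i2))
    exact integral_congr_ae (ae_of_all _ fun ω => by dsimp only [Pi.add_apply]; ring)
  have hd := discrim_le_zero (a := ∫ ω, k ω ^ 2 ∂P) (b := 2 * ∫ ω, g ω * k ω ∂P) (c := 0)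
    fun t => by have := hmin t; rw [hexp] at this; linarith
  rw [discrim] at hd
  nlinarith [sq_nonneg (∫ ω, g ω * k ω ∂P)]

variable {ι : Type*} [Fintype ι] [DecidableEq ι] {z : Ω → EuclideanSpace ℝ ι}

theorem memLp_apply_of_inner (hz : ∀ θ : EuclideanSpace ℝ ι, MemLp (fun ω => inner ℝ θ (z ω)) 2 P)
    (i : ι) : MemLp (fun ω => z ω i) 2 P := by
  simpa [EuclideanSpace.inner_single_left] using hz (EuclideanSpace.single i 1)

theorem integral_inner_mul_inner
    (hz : ∀ θ : EuclideanSpace ℝ ι, MemLp (fun ω => inner ℝ θ (z ω)) 2 P)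
    (u v : EuclideanSpace ℝ ι) :
    ∫ ω, inner ℝ u (z ω) * inner ℝ v (z ω) ∂P =
      inner ℝ u (Matrix.toEuclideanLin (secondMoment P z) v) := by
  have hi (i j : ι) : Integrable (fun ω => z ω i * z ω j) P :=
    (memLp_apply_of_inner hz i).integrable_mul (memLp_apply_of_inner hz j)
  have hexp (ω : Ω) : inner ℝ u (z ω) * inner ℝ v (z ω) =
      ∑ i, ∑ j, u i * (v j * (z ω i * z ω j)) := by
    simp only [PiLp.inner_apply, Finset.sum_mul_sum, RCLike.inner_apply, conj_trivial]
    exact Finset.sum_congr rfl fun i _ => Finset.sum_congr rfl fun j _ => by ring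
  simp only [hexp]
  rw [integral_finsetSum _ fun i _ => integrable_finsetSum _ fun j _ =>
    ((hi i j).const_mul _).const_mul _, inner_toEuclideanLin_eq, dotProduct]
  refine Finset.sum_congr rfl fun i _ => ?_
  rw [integral_finsetSum _ fun j _ => ((hi i j).const_mul _).const_mul _, Matrix.mulVec,
    dotProduct, Finset.mul_sum]
  refine Finset.sum_congr rfl fun j _ => ?_
  rw [integral_const_mul, integral_const_mul, secondMoment, Matrix.of_apply]
  ring

/-- The normal equations for a best linear predictor. -/
theorem IsBestLinearPredictor.normal_eq {y : Ω → ℝ} {β b : EuclideanSpace ℝ ι}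
    (hz : ∀ θ : EuclideanSpace ℝ ι, MemLp (fun ω => inner ℝ θ (z ω)) 2 P) (hy : MemLp y 2 P)
    (hb : ∀ θ : EuclideanSpace ℝ ι, ∫ ω, y ω * inner ℝ θ (z ω) ∂P = inner ℝ θ b)
    (h : IsBestLinearPredictor P z y β) :
    Matrix.toEuclideanLin (secondMoment P z) β = b := by
  refine ext_inner_left ℝ fun θ => ?_
  have h0 : ∫ ω, (inner ℝ β (z ω) - y ω) * inner ℝ θ (z ω) ∂P = 0 := by
    refine integral_mul_eq_zero_of_minimal ((hz β).sub hy) (hz θ) fun t => ?_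
    have := h (Set.mem_univ (β + t • θ))
    refine (show _ ≤ _ from this).trans (le_of_eq ?_)
    refine integral_congr_ae (ae_of_all _ fun ω => ?_)
    dsimp only
    rw [inner_add_left, real_inner_smul_left]; ring
  have i1 : Integrable (fun ω => inner ℝ θ (z ω) * inner ℝ β (z ω)) P :=
    (hz θ).integrable_mul (hz β)
  have i2 : Integrable (fun ω => y ω * inner ℝ θ (z ω)) P := hy.integrable_mul (hz θ)
  rw [← integral_inner_mul_inner hz, ← hb θ, ← sub_eq_zero, ← integral_sub i1 i2, ← h0]
  exact integral_congr_ae (ae_of_all _ fun ω => by dsimp only; ring)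

end

/-! ### The estimation bound -/

/-- Absorption of the cross terms: the bias `|μ - e| ≤ B` and the fluctuation `L μ + q` combine
into half of `e²` plus squared error terms. -/
theorem abs_sub_sq_le {U μ e B L q : ℝ} (he : 0 ≤ e) (hL : 0 ≤ L) (hμe : |μ - e| ≤ B)
    (hU : |U - μ ^ 2| ≤ L * μ + q) :
    |U - e ^ 2| ≤ e ^ 2 / 2 + 6 * B ^ 2 + 2 * L ^ 2 + q := by
  have hB : 0 ≤ B := (abs_nonneg _).trans hμe
  obtain ⟨h1, h2⟩ := abs_le.1 hμe
  have hμ : μ ≤ e + B := by linarith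
  have hsq : |μ ^ 2 - e ^ 2| ≤ B * (2 * e + B) := by
    have : μ ^ 2 - e ^ 2 = (μ - e) * (2 * e + (μ - e)) := by ring
    rw [this, abs_mul]
    refine mul_le_mul hμe ?_ (abs_nonneg _) hB
    refine (abs_add_le _ _).trans (add_le_add ?_ hμe)
    rw [abs_of_nonneg (by positivity)]
  have htri : |U - e ^ 2| ≤ |U - μ ^ 2| + |μ ^ 2 - e ^ 2| := abs_sub_le _ _ _
  have h3 : L * μ ≤ L * (e + B) := mul_le_mul_of_nonneg_left hμ hL
  nlinarith [sq_nonneg (e / 2 - 2 * B), sq_nonneg (e / 2 - L), sq_nonneg (L - B)]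

/-- The logarithmic factor dominates a moment order at which the tail probability is below `δ`. -/
theorem exists_moment_order {d : ℕ} (hd : 1 ≤ d) {δ : ℝ} (h0 : 0 < δ) (h1 : δ < 1) :
    ∃ m : ℕ, 1 ≤ m ∧ (m : ℝ) ≤ 5 * Real.log (2 * (d : ℝ) / δ) ∧
      20 * Real.exp (-(2 * m)) ≤ δ := by
  set l := Real.log (2 * (d : ℝ) / δ) with hl
  have hd' : (1 : ℝ) ≤ d := by exact_mod_cast hd
  have harg : 2 / δ ≤ 2 * (d : ℝ) / δ := by gcongr; linarith
  have hl2 : Real.log 2 ≤ l := by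
    refine Real.log_le_log (by norm_num) (le_trans ?_ harg)
    rw [le_div_iff₀ h0]; linarith
  have hlog2 := Real.log_two_gt_d9
  have hexp : Real.exp (-l) ≤ δ / 2 := by
    rw [hl, Real.exp_neg, Real.exp_log (by positivity)]
    calc (2 * (d : ℝ) / δ)⁻¹ ≤ (2 / δ)⁻¹ := by gcongr
      _ = δ / 2 := inv_div _ _
  refine ⟨⌈3 * l⌉₊, Nat.one_le_ceil_iff.2 (by linarith), ?_, ?_⟩
  · have := (Nat.ceil_lt_add_one (show 0 ≤ 3 * l by linarith)).le
    linarith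
  · have hm := Nat.le_ceil (3 * l)
    have h6 : Real.exp (-(2 * (⌈3 * l⌉₊ : ℝ))) ≤ (δ / 2) ^ 6 := by
      calc Real.exp (-(2 * (⌈3 * l⌉₊ : ℝ))) ≤ Real.exp ((6 : ℕ) * -l) := by
            apply Real.exp_le_exp.2; push_cast; linarith
        _ = Real.exp (-l) ^ 6 := Real.exp_nat_mul _ _
        _ ≤ (δ / 2) ^ 6 := by gcongr
    have h5 : δ ^ 6 ≤ δ := pow_le_of_le_one h0.le h1.le (by norm_num)
    have : (δ / 2) ^ 6 = δ ^ 6 / 64 := by ring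
    linarith

theorem mainTheorem3 :
    ∃ C : ℝ, 0 < C ∧
      ∀ (d₁ d₂ n : ℕ) (_ : 1 ≤ d₁ + d₂) (_ : 2 ≤ n)
        (D : Measure (EuclideanSpace ℝ (Fin d₁ ⊕ Fin d₂) × ℝ)) (_ : IsProbabilityMeasure D)
        (σ τ ε δ : ℝ) (_ : 0 ≤ σ) (_ : 0 ≤ τ) (_ : ε ≤ 1 / 2) (_ : 0 < δ) (_ : δ < 1)
        (_ : IsSubGVec D (fun z => z.1) τ) (_ : IsSubG D (fun z => z.2) σ)
        (Sig : Matrix (Fin d₁ ⊕ Fin d₂) (Fin d₁ ⊕ Fin d₂) ℝ)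
        (_ : Sig = secondMoment D (fun z => z.1)) (_ : Sig.PosDef)
        (Sig₁ : Matrix (Fin d₁) (Fin d₁) ℝ)
        (_ : Sig₁ = secondMoment D (fun z => firstBlock z.1))
        (β : EuclideanSpace ℝ (Fin d₁ ⊕ Fin d₂)) (β₁ : EuclideanSpace ℝ (Fin d₁))
        (_ : IsBestLinearPredictor D (fun z => z.1) (fun z => z.2) β)
        (_ : IsBestLinearPredictor D (fun z => firstBlock z.1) (fun z => z.2) β₁)
        (E : ℝ) (_ : E = ∫ z, (inner ℝ β₁ (firstBlock z.1) - inner ℝ β z.1) ^ 2 ∂D)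
        (S : Matrix (Fin d₁ ⊕ Fin d₂) (Fin d₁ ⊕ Fin d₂) ℝ) (S₁ : Matrix (Fin d₁) (Fin d₁) ℝ)
        (_ : S.IsHermitian) (_ : S₁.IsHermitian)
        (_ : SpectrallyClose Sig S ε) (_ : SpectrallyClose Sig₁ S₁ ε),
        1 - δ ≤ (Measure.pi fun _ : Fin n => D).real
          {data | |estimateResidual data S S₁ - E| ≤ E / 2 +
            C * (lamMax Sig / lamMin Sig ^ 2 *
                  (σ ^ 2 * τ ^ 2 * Real.sqrt ((d₁ + d₂ : ℕ) : ℝ) *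
                    Real.log (2 * ((d₁ + d₂ : ℕ) : ℝ) / δ) ^ 2 / n) +
                lamMax Sig / lamMin Sig ^ 2 * ‖∫ z, z.2 • z.1 ∂D‖ ^ 2 * ε ^ 2)} := by
  refine ⟨10 ^ 9, by norm_num, ?_⟩
  intro d₁ d₂ n hd hn D _ σ τ ε δ hσ hτ hε hδ0 hδ1 hx hy Sig hSig hSigP Sig₁ hSig₁ β β₁ hβ hβ₁ E hE
    S S₁ hS hS₁ hclose hclose₁
  have hcard : Fintype.card (Fin d₁ ⊕ Fin d₂) = d₁ + d₂ := by simp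
  have : Nonempty (Fin d₁ ⊕ Fin d₂) := Fintype.card_pos_iff.1 (by omega)
  have hn' : (2 : ℝ) ≤ n := by exact_mod_cast hn
  have hblock : Sig₁ = Sig.toBlocks₁₁ := by rw [hSig, hSig₁]; rfl
  rw [hblock] at hclose₁
  have hε0 := hclose.eps_nonneg hS
  have hL := hclose.loewnerClose hSigP hS hε
  have hL₁ := hclose₁.loewnerClose hSigP.toBlocks₁₁_posDef hS₁ hε
  set lam := lamMin Sig with hlamdef
  have hlam : 0 < lam := lamMin_pos hSigP
  have hform := lamMin_mul_norm_sq_le hSigP.posSemidef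
  have hSP := hL.posDef hS hε hlam hform
  set b := ∫ z, z.2 • z.1 ∂D with hb
  have hsub := centeredSubExpVec_smul hσ hτ hx hy
  rw [← hb] at hsub
  have hint := integrable_smul hτ hx hy
  -- The normal equations identify `β` and `β₁`.
  have hz (θ : EuclideanSpace ℝ (Fin d₁ ⊕ Fin d₂)) :
      MemLp (fun z : EuclideanSpace ℝ (Fin d₁ ⊕ Fin d₂) × ℝ => (inner ℝ θ z.1 : ℝ)) 2 D := by
    refine ⟨(measurable_inner_fst θ).aestronglyMeasurable, ?_⟩
    have := hx.eLpNorm_inner_le θ (p := 2) (by norm_num)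
    rw [ENNReal.ofReal_ofNat] at this
    exact this.trans_lt ENNReal.ofReal_lt_top
  have hy2 : MemLp (fun z : EuclideanSpace ℝ (Fin d₁ ⊕ Fin d₂) × ℝ => z.2) 2 D := by
    refine ⟨measurable_snd.aestronglyMeasurable, ?_⟩
    have := hy.eLpNorm_le (p := 2) (by norm_num)
    rw [ENNReal.ofReal_ofNat] at this
    exact this.trans_lt ENNReal.ofReal_lt_top
  have hbθ (θ : EuclideanSpace ℝ (Fin d₁ ⊕ Fin d₂)) :
      ∫ z, z.2 * inner ℝ θ z.1 ∂D = inner ℝ θ b := by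
    rw [hb, ← integral_inner hint]
    simp only [real_inner_smul_right]
  have hz₁ (θ : EuclideanSpace ℝ (Fin d₁)) : MemLp
      (fun z : EuclideanSpace ℝ (Fin d₁ ⊕ Fin d₂) × ℝ => (inner ℝ θ (firstBlock z.1) : ℝ)) 2 D := by
    simp only [← inner_extendZero]; exact hz _
  have hβeq : Matrix.toEuclideanLin Sig β = b := by
    rw [hSig]; exact hβ.normal_eq hz hy2 hbθ
  have hβ₁eq : Matrix.toEuclideanLin Sig.toBlocks₁₁ β₁ = firstBlock b := by
    rw [← hblock, hSig₁]
    refine hβ₁.normal_eq hz₁ hy2 fun θ => ?_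
    simp only [← inner_extendZero]; exact hbθ _
  have hEeq : E = matNorm Sig (extendZero β₁ - β) ^ 2 := by
    rw [hSigP.posSemidef.matNorm_sq, hE]
    conv_rhs => rw [hSig]
    rw [← integral_inner_mul_inner hz]
    refine integral_congr_ae (ae_of_all _ fun z => ?_)
    dsimp only
    rw [inner_sub_left, inner_extendZero, sq]
  -- The estimator is a U-statistic with kernel `⟨A u, A v⟩`.
  let A := Matrix.toEuclideanCLM (𝕜 := ℝ) (CFC.sqrt S * residualMatrix S S₁)
  have hA (v : EuclideanSpace ℝ (Fin d₁ ⊕ Fin d₂)) :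
      A v = Matrix.toEuclideanLin (CFC.sqrt S * residualMatrix S S₁) v := rfl
  have hAn (v : EuclideanSpace ℝ (Fin d₁ ⊕ Fin d₂)) :
      ‖A v‖ = matNorm S (Matrix.toEuclideanLin (residualMatrix S S₁) v) := by
    rw [hA, toEuclideanLin_mul, matNorm]
  have hest (data : Fin n → EuclideanSpace ℝ (Fin d₁ ⊕ Fin d₂) × ℝ) :
      estimateResidual data S S₁ = (1 / (n.choose 2 : ℝ)) * ∑ s, ∑ t ∈ Finset.Ioi s,
        inner ℝ (A ((data s).2 • (data s).1 - b + b)) (A ((data t).2 • (data t).1 - b + b)) := by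
    simp only [sub_add_cancel]; rfl
  have hsl : 0 < Real.sqrt lam := Real.sqrt_pos.2 hlam
  have hAop : ‖A‖ ≤ 12 / Real.sqrt lam := by
    refine A.opNorm_le_bound (by positivity) fun v => ?_
    -- The bound on `R̂ v` needs some solution of the two linear systems with right-hand side `v`.
    obtain ⟨h1, -⟩ := residual_bounds hSigP hS hS₁ hL hL₁ hε0 hε hlam hform v _ _
      (toEuclideanLin_inv_left hSigP v)
      (toEuclideanLin_inv_left hSigP.toBlocks₁₁_posDef (firstBlock v))
    rw [hAn]
    refine (hL.matNorm_le hSP.posSemidef hε0 _).2.trans ?_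
    calc _ ≤ (1 + 1 / 2) * (8 * (‖v‖ / Real.sqrt lam)) :=
          mul_le_mul (by linarith) h1 (matNorm_nonneg _ _) (by norm_num)
      _ = _ := by ring
  have hbias : |‖A b‖ - matNorm Sig (extendZero β₁ - β)| ≤ 56 * ε * (‖b‖ / Real.sqrt lam) := by
    obtain ⟨h1, h2⟩ := residual_bounds hSigP hS hS₁ hL hL₁ hε0 hε hlam hform b β β₁ hβeq hβ₁eq
    rw [hAn]
    obtain ⟨h3, h4⟩ := hL.matNorm_le hSP.posSemidef hε0
      (Matrix.toEuclideanLin (residualMatrix S S₁) b)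
    have h5 := (abs_matNorm_sub_le _ _ _).trans h2
    have h6 := mul_le_mul_of_nonneg_left h1 hε0
    rw [abs_le] at h5 ⊢
    constructor <;> linarith [h5.1, h5.2]
  obtain ⟨m, hm1, hml, hmδ⟩ := exists_moment_order hd hδ0 hδ1
  have hconc := hsub.uStat_concentration hn hm1 b A
  have hmono : 1 - δ ≤ 1 - 20 * Real.exp (-(2 * m)) := by linarith
  refine hmono.trans (hconc.trans (measureReal_mono ?_))
  intro data hdata
  rw [Set.mem_ofPred_eq] at hdata ⊢
  rw [← hest] at hdata
  have hfin := abs_sub_sq_le (matNorm_nonneg _ _)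
    (by have := hsub.nonneg; positivity) hbias hdata
  rw [← hEeq] at hfin
  refine hfin.trans ?_
  set l := Real.log (2 * ((d₁ + d₂ : ℕ) : ℝ) / δ) with hl
  have hcard' : (Fintype.card (Fin d₁ ⊕ Fin d₂) : ℝ) = ((d₁ + d₂ : ℕ) : ℝ) := by rw [hcard]
  rw [hcard']
  have hsd : 1 ≤ Real.sqrt ((d₁ + d₂ : ℕ) : ℝ) := Real.one_le_sqrt.2 (by exact_mod_cast hd)
  set r := Real.sqrt ((d₁ + d₂ : ℕ) : ℝ) with hr
  have hn0 : (0 : ℝ) < n := by linarith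
  have hratio : 1 / lam ≤ lamMax Sig / lam ^ 2 := by
    rw [div_le_div_iff₀ hlam (by positivity)]
    have := lamMin_le_lamMax hSigP.1
    nlinarith
  have hl0 : 0 ≤ l := by
    have : (0 : ℝ) ≤ m := by positivity
    linarith
  have hX : (m * (4 * (σ * τ)) * ‖A‖) ^ 2 ≤ 57600 * (1 / lam * (σ ^ 2 * τ ^ 2 * l ^ 2)) := by
    calc (m * (4 * (σ * τ)) * ‖A‖) ^ 2
        ≤ (5 * l * (4 * (σ * τ)) * (12 / Real.sqrt lam)) ^ 2 := by gcongr
      _ = 57600 * (1 / Real.sqrt lam ^ 2 * (σ ^ 2 * τ ^ 2 * l ^ 2)) := by ring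
      _ = _ := by rw [Real.sq_sqrt hlam.le]
  set X := (m * (4 * (σ * τ)) * ‖A‖) ^ 2 with hXdef
  have hX0 : 0 ≤ X := sq_nonneg _
  have hlin : (72 * (m * (4 * (σ * τ)) * ‖A‖ / Real.sqrt n)) ^ 2 ≤ 5184 * (X * r / n) := by
    rw [mul_pow, div_pow, Real.sq_sqrt hn0.le, ← hXdef]
    have : X ≤ X * r := le_mul_of_one_le_right hX0 hsd
    have : X / n ≤ X * r / n := by gcongr
    linarith
  have hXr : X * r / n ≤ 57600 * (lamMax Sig / lam ^ 2 * (σ ^ 2 * τ ^ 2 * r * l ^ 2 / n)) := by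
    calc X * r / n ≤ 57600 * (lamMax Sig / lam ^ 2 * (σ ^ 2 * τ ^ 2 * l ^ 2)) * r / n := by
          gcongr
          exact hX.trans (by gcongr)
      _ = _ := by ring
  have hBB : (56 * ε * (‖b‖ / Real.sqrt lam)) ^ 2 ≤
      3136 * (lamMax Sig / lam ^ 2 * ‖b‖ ^ 2 * ε ^ 2) := by
    calc (56 * ε * (‖b‖ / Real.sqrt lam)) ^ 2
        = 3136 * (1 / Real.sqrt lam ^ 2 * ‖b‖ ^ 2 * ε ^ 2) := by ring
      _ = 3136 * (1 / lam * ‖b‖ ^ 2 * ε ^ 2) := by rw [Real.sq_sqrt hlam.le]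
      _ ≤ _ := by gcongr
  have hk0 : 0 ≤ lamMax Sig / lam ^ 2 := le_trans (by positivity) hratio
  have hY0 : 0 ≤ lamMax Sig / lam ^ 2 * (σ ^ 2 * τ ^ 2 * r * l ^ 2 / n) := by positivity
  have hZ0 : 0 ≤ lamMax Sig / lam ^ 2 * ‖b‖ ^ 2 * ε ^ 2 := by positivity
  linarith
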